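/- Let $\{d_k\}_{k\ge1}$ be a sequence of real numbers, let $f(t)=1+d_1t+d_2t^2+\cdots$, and define $a_k$ by $\ln f(t)=\sum_{k\ge1}a_kt^k$. Assume $0<d_1<1$ and $k|a_k|\le 1$ for all $k\ge1$. For a finite field $\mathbb F_q$ let $\pi_q(l)$ be the number of monic irreducible polynomials of degree $l$ over $\mathbb F_q$, and let $g$ be a real-valued multiplicative function on $\mathbb F_q[T]$ with $g(P^k)=d_k$ for every irreducible $P$ and every $k\ge1$. Put $$T(N)=\sum_{F\ \text{monic},\ \deg F=N}g(F).$$ (i) The series $f(t)$ converges for $|t|<1$, and the infinite product $$a(x)=\prod_{l\ge1}\bigl\{f(x^l)(1-x^l)^{d_1}\bigr\}^{\pi_q(l)}$$ converges (to a nonzero value) for all complex $x$ with $|x|<1/\sqrt q$ and defines a holomorphic function there. (ii) For every integer $n\ge0$ and every $N\ge n+1$, $$T(N)=M_n(N)+R_n,\qquad M_n(N)=(-1)^N\binom{-d_1}{N}q^N\left(a(q^{-1})+\sum_{k=1}^n\frac{\binom{k-d_1}{k}}{\binom{N+d_1-1}{k}}\,\frac{q^{-k}}{k!}\,a^{(k)}(q^{-1})\right),$$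 where $$|R_n|\le C_n\,q^N N^{d_1-1}\left(\frac1{\sqrt q\,N}\right)^{n+1}$$ with a constant $C_n>0$ depending only on $n$ (not on $q$, $N$, $g$ or the sequence $\{d_k\}$). (iii) For a fixed sequence $\{d_k\}$ and fixed $n\ge0$ the main term gives the asymptotics of $T(N)$ whenever $q^N\to\infty$: for every $\varepsilon>0$ there is $M$ such that for every finite field $\mathbb F_q$, every $g$ as above and every $N\ge n+1$ with $q^N\ge M$ one has $M_n(N)\ne0$ and $|T(N)-M_n(N)|\le\varepsilon\,|M_n(N)|$. -/

import Mathlib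

open Polynomial

universe u

namespace FqMean

section Polynomials

/-- The monic polynomials of degree `N` over `K`. -/
def monicsOfDegree (K : Type u) [Field K] (N : ℕ) : Set K[X] :=
  {F | F.Monic ∧ F.natDegree = N}

theorem finite_monicsOfDegree (K : Type u) [Field K] [Fintype K] (N : ℕ) :
    (monicsOfDegree K N).Finite := by
  refine Set.Finite.of_injOn (f := fun F : K[X] => fun i : Fin N => F.coeff i)
    (t := Set.univ) (fun _ _ => Set.mem_univ _) ?_ Set.finite_univ
  intro F hF G hG h
  ext i
  rcases lt_trichotomy i N with hi | hi | hi
  · exact congrFun h ⟨i, hi⟩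
  · have h1 := hF.1.coeff_natDegree
    have h2 := hG.1.coeff_natDegree
    rw [hF.2] at h1
    rw [hG.2] at h2
    rw [hi, h1, h2]
  · rw [coeff_eq_zero_of_natDegree_lt (hF.2.trans_lt hi),
      coeff_eq_zero_of_natDegree_lt (hG.2.trans_lt hi)]

/-- `π_q(l)`: the number of monic irreducible polynomials of degree `l` over `K`. -/
noncomputable def primeCount (K : Type u) [Field K] (l : ℕ) : ℕ :=
  Set.ncard {P : K[X] | P.Monic ∧ Irreducible P ∧ P.natDegree = l}

/-- `g` is multiplicative on monic polynomials. -/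
def IsMultiplicative {K : Type u} [Field K] (g : K[X] → ℝ) : Prop :=
  g 1 = 1 ∧ ∀ F G : K[X], F.Monic → G.Monic → IsCoprime F G → g (F * G) = g F * g G

/-- `g (P ^ k) = d k` for every monic irreducible `P` and every `k ≥ 1`. -/
def HasPrimePowerValues {K : Type u} [Field K] (g : K[X] → ℝ) (d : ℕ → ℝ) : Prop :=
  ∀ P : K[X], P.Monic → Irreducible P → ∀ k : ℕ, 1 ≤ k → g (P ^ k) = d k

/-- `T(N)`: the sum of `g F` over the monic polynomials `F` of degree `N`. -/
noncomputable def T {K : Type u} [Field K] [Fintype K] (g : K[X] → ℝ) (N : ℕ) : ℝ :=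
  ∑ F ∈ (finite_monicsOfDegree K N).toFinset, g F

end Polynomials

section Series

/-- The formal power series `1 + d₁ t + d₂ t² + ⋯` (the value `d 0` plays no role). -/
noncomputable def fSeries (d : ℕ → ℝ) : PowerSeries ℝ :=
  PowerSeries.mk fun k => if k = 0 then 1 else d k

/-- The coefficients `a_k` in `ln f(t) = ∑_{k ≥ 1} a_k t^k`. -/
noncomputable def logCoeff (d : ℕ → ℝ) (k : ℕ) : ℝ :=
  PowerSeries.coeff k (PowerSeries.logOf (fSeries d))

/-- The sum `f(t) = 1 + d₁ t + d₂ t² + ⋯` at a complex number `t`. -/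
noncomputable def f (d : ℕ → ℝ) (t : ℂ) : ℂ :=
  ∑' k : ℕ, ((PowerSeries.coeff k (fSeries d) : ℝ) : ℂ) * t ^ k

/-- The factor `{f(x^l) (1 - x^l)^{d₁}}^{π_q(l)}` (principal branch of the power). -/
noncomputable def factor (K : Type u) [Field K] (d : ℕ → ℝ) (l : ℕ) (x : ℂ) : ℂ :=
  (f d (x ^ l) * (1 - x ^ l) ^ ((d 1 : ℝ) : ℂ)) ^ primeCount K l

/-- `a(x) = ∏_{l ≥ 1} {f(x^l) (1 - x^l)^{d₁}}^{π_q(l)}`. -/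
noncomputable def a (K : Type u) [Field K] (d : ℕ → ℝ) (x : ℂ) : ℂ :=
  ∏' l : ℕ, factor K d (l + 1) x

/-- The main term
`(-1)^N binom(-d₁, N) q^N (a(1/q) + ∑_{k=1}^n binom(k-d₁,k)/binom(N+d₁-1,k) q^{-k} a^{(k)}(1/q)/k!)`
with `q` the cardinality of `K`. -/
noncomputable def mainTerm (K : Type u) [Field K] [Fintype K] (d : ℕ → ℝ) (n N : ℕ) : ℂ :=
  (((-1 : ℝ) ^ N * Ring.choose (-d 1) N * (Fintype.card K : ℝ) ^ N : ℝ) : ℂ) *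
    (a K d (1 / (Fintype.card K : ℂ)) +
      ∑ k ∈ Finset.Icc 1 n,
        ((Ring.choose ((k : ℝ) - d 1) k / Ring.choose ((N : ℝ) + d 1 - 1) k : ℝ) : ℂ) *
          (1 / (Fintype.card K : ℂ) ^ k / (k.factorial : ℂ)) *
            iteratedDeriv k (a K d) (1 / (Fintype.card K : ℂ)))

end Series

end FqMean

/-! Write `q` for the size of the field. The generating series of `T` factors formally as `∑ T(N)
x^N = a(x) (1 - q x)^(-d₁)` (`mk_T_eq`). Both sides have the same logarithmic derivative: on the
left this comes from counting `g(F) deg F` over the prime powers dividing `F` (`natCast_mul_T`), on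
the right from `∑_{l ∣ m} l π(l) = q^m` (`primePowerSum_one`).

The factor `(1 - x^l)^(d₁)` cancels the first-order term of `ln f(x^l)`, so only primes of degree at
most `m/2` contribute to the `m`-th coefficient of `log a`. That coefficient is at most `4 q^(m/2) /
m` in absolute value, hence `a` is majorized by `(1 - √q x)^(-4)` (`abs_coeff_aSeries_le`). This
gives holomorphy and absolute rearrangement of the Euler product for `|x| < 1/√q`, a disc that
contains `1/q`.

For the expansion put `y = q x` and let `α_m` be the coefficients of `a`. In `∑ α_m q^(-m) y^m (1 -
y)^(-d₁)` each `y^m` is replaced by its Taylor polynomial of order `n` at `y = 1`. The polynomials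
add up to the main term, since `∑ α_m q^(-m) binom(m, k)` is the scaled `k`-th derivative of `a` at
`1/q`. The remainder has a factor `(1 - y)^(n+1-d₁)`, whose `N`-th coefficient is `O(N^(d₁-n-2))`
uniformly in `d₁` (`abs_multichoose_mul_rpow_le`, `abs_remainderCoeff_le`). It vanishes for `m ≤ n`,
so the sum against `q^(-m/2)` starts at `m = n + 1` and saves `q^(-(n+1)/2)`.

For the asymptotics, the main term of order zero has size at least a constant times `q^N N^(d₁-1)`.
The main term of order `n` differs from it by a relative `O(1/(√q N))`, and `√q N` is large whenever
`q^N` is. -/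

namespace FqMean

/-! ### Formal exponentials, characterized by their logarithmic derivative. -/

section FormalExponential

/-- `A` is the formal exponential of `L`, expressed through the logarithmic derivative. -/
def IsExp (A L : PowerSeries ℝ) : Prop :=
  PowerSeries.constantCoeff A = 1 ∧
    PowerSeries.derivative ℝ A = PowerSeries.derivative ℝ L * A

theorem IsExp.mul {A B L M : PowerSeries ℝ} (hA : IsExp A L) (hB : IsExp B M) :
    IsExp (A * B) (L + M) := by
  refine ⟨by rw [map_mul, hA.1, hB.1, one_mul], ?_⟩
  rw [Derivation.leibniz, map_add, hA.2, hB.2, smul_eq_mul, smul_eq_mul]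
  ring

/-- The quotient `A / B` has zero derivative and constant term one. -/
theorem IsExp.unique {A B L : PowerSeries ℝ} (hA : IsExp A L) (hB : IsExp B L) : A = B := by
  have hB0 : PowerSeries.constantCoeff B ≠ 0 := by rw [hB.1]; exact one_ne_zero
  have h1 : B * B⁻¹ = 1 := PowerSeries.mul_inv_cancel B hB0
  have h : A * B⁻¹ = 1 := by
    apply PowerSeries.derivative.ext
    · rw [Derivation.leibniz, PowerSeries.derivative_inv', hA.2, hB.2,
        PowerSeries.derivative_one, smul_eq_mul, smul_eq_mul]
      linear_combination (-(A * B⁻¹ * PowerSeries.derivative ℝ L)) * h1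
    · rw [map_mul, hA.1, PowerSeries.constantCoeff_inv, hB.1, map_one]; norm_num
  linear_combination B * h - A * h1

theorem isExp_exp_subst {L : PowerSeries ℝ} (hL : PowerSeries.constantCoeff L = 0) :
    IsExp ((PowerSeries.exp ℝ).subst L) L := by
  have hs : PowerSeries.HasSubst L := PowerSeries.HasSubst.of_constantCoeff_zero' hL
  constructor
  · have h2 : (PowerSeries.exp ℝ).subst L
        = (PowerSeries.exp ℝ - 1).subst L + (1 : PowerSeries ℝ) := by
      have h3 : PowerSeries.exp ℝ = (PowerSeries.exp ℝ - 1) + 1 := by ring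
      conv_lhs => rw [h3, PowerSeries.subst_add hs]
      congr 1
      rw [← PowerSeries.coe_substAlgHom hs, map_one]
    rw [h2, map_add, map_one]
    have : PowerSeries.constantCoeff ((PowerSeries.exp ℝ - 1).subst L) = 0 :=
      PowerSeries.constantCoeff_subst_eq_zero hL _ (by simp)
    rw [this, zero_add]
  · rw [PowerSeries.derivative_subst hs, mul_comm]
    congr 2
    ext n
    rw [PowerSeries.coeff_derivative, PowerSeries.coeff_exp, PowerSeries.coeff_exp]
    simp [Nat.factorial_succ]
    have : (n : ℝ) + 1 ≠ 0 := by positivity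
    have := Nat.factorial_ne_zero n
    field_simp

theorem isExp_logOf {A : PowerSeries ℝ} (hA : PowerSeries.constantCoeff A = 1) :
    IsExp A (PowerSeries.logOf A) := by
  refine ⟨hA, ?_⟩
  have h0 : PowerSeries.constantCoeff (A - 1) = 0 := by rw [map_sub, hA, map_one, sub_self]
  have hs : PowerSeries.HasSubst (A - 1) := PowerSeries.HasSubst.of_constantCoeff_zero' h0
  rw [PowerSeries.logOf_eq, PowerSeries.derivative_subst hs, map_sub,
    PowerSeries.derivative_one, sub_zero]
  -- Substituting `A - 1` for `X` in this identity shows that the outer factor of the chain rule is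
  -- the inverse of `A`.
  have h1 : PowerSeries.derivative ℝ (PowerSeries.log ℝ) * (1 + PowerSeries.X) = 1 := by
    rw [PowerSeries.deriv_log, mul_add, mul_one]
    ext n
    cases n with
    | zero => simp
    | succ n =>
      rw [map_add, PowerSeries.coeff_succ_mul_X]
      simp [pow_succ, PowerSeries.coeff_one]
  have h2 := congrArg (PowerSeries.substAlgHom hs) h1
  rw [map_mul, map_add, map_one, PowerSeries.coe_substAlgHom hs, PowerSeries.subst_X hs] at h2
  have h3 : (1 : PowerSeries ℝ) + (A - 1) = A := by ring
  rw [h3] at h2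
  linear_combination (-(PowerSeries.derivative ℝ A)) * h2

/-- Comparing coefficients in `A' = L' A` gives a recursion that determines `A` from `L`. Its
weights are nonnegative, which is why majorants of `L` pass to majorants of `A`. -/
theorem IsExp.coeff_succ {A L : PowerSeries ℝ} (h : IsExp A L) (n : ℕ) :
    ((n : ℝ) + 1) * PowerSeries.coeff (n + 1) A =
      ∑ p ∈ Finset.HasAntidiagonal.antidiagonal n,
        ((p.1 : ℝ) + 1) * PowerSeries.coeff (p.1 + 1) L * PowerSeries.coeff p.2 A := by
  have h1 := congrArg (PowerSeries.coeff n) h.2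
  rw [PowerSeries.coeff_derivative, PowerSeries.coeff_mul] at h1
  rw [mul_comm, h1]
  refine Finset.sum_congr rfl fun p _ => ?_
  rw [PowerSeries.coeff_derivative]; ring

theorem isExp_of_coeff_succ {A L : PowerSeries ℝ} (h0 : PowerSeries.coeff 0 A = 1)
    (h : ∀ n : ℕ, ((n : ℝ) + 1) * PowerSeries.coeff (n + 1) A =
      ∑ p ∈ Finset.HasAntidiagonal.antidiagonal n,
        ((p.1 : ℝ) + 1) * PowerSeries.coeff (p.1 + 1) L * PowerSeries.coeff p.2 A) :
    IsExp A L := by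
  refine ⟨by simpa using h0, ?_⟩
  ext n
  rw [PowerSeries.coeff_derivative, PowerSeries.coeff_mul, mul_comm, h]
  refine Finset.sum_congr rfl fun p _ => ?_
  rw [PowerSeries.coeff_derivative]; ring

/-- Coefficientwise comparison of formal exponentials. -/
theorem IsExp.abs_coeff_le {A L B M : PowerSeries ℝ} (hA : IsExp A L) (hB : IsExp B M)
    (h : ∀ n, |PowerSeries.coeff (n + 1) L| ≤ PowerSeries.coeff (n + 1) M) (n : ℕ) :
    |PowerSeries.coeff n A| ≤ PowerSeries.coeff n B := by
  induction n using Nat.strong_induction_on with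
  | _ n ih =>
    cases n with
    | zero =>
      have h1 := hA.1
      have h2 := hB.1
      rw [← PowerSeries.coeff_zero_eq_constantCoeff_apply] at h1 h2
      rw [h1, h2, abs_one]
    | succ n =>
      have hn : (0 : ℝ) < n + 1 := by positivity
      refine le_of_mul_le_mul_left ?_ hn
      rw [hB.coeff_succ, ← abs_of_pos hn, ← abs_mul, hA.coeff_succ]
      refine (Finset.abs_sum_le_sum_abs _ _).trans (Finset.sum_le_sum fun p hp => ?_)
      have hp2 : p.2 < n + 1 := by
        have := Finset.HasAntidiagonal.mem_antidiagonal.mp hp; omega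
      have hp1 : (0 : ℝ) < p.1 + 1 := by positivity
      rw [abs_mul, abs_mul, abs_of_pos hp1]
      exact mul_le_mul (mul_le_mul_of_nonneg_left (h _) hp1.le) (ih _ hp2) (abs_nonneg _)
        (mul_nonneg hp1.le ((abs_nonneg _).trans (h _)))

end FormalExponential

/-! ### Termwise differentiation of power series and passage from formal to analytic exponentials.
-/

section AnalyticPowerSeries

theorem summable_succ_mul_coeff {c : ℕ → ℂ} {r : ℝ}
    (hc : ∀ x : ℂ, ‖x‖ < r → Summable fun n => c n * x ^ n) {x : ℂ} (hx : ‖x‖ < r) :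
    Summable fun n : ℕ => ‖((n : ℂ) + 1) * c (n + 1) * x ^ n‖ := by
  obtain ⟨ρ, hxρ, hρr⟩ := exists_between hx
  have hρ0 : 0 < ρ := (norm_nonneg x).trans_lt hxρ
  have hsum := hc (ρ : ℂ) (by simpa [abs_of_pos hρ0] using hρr)
  have hb := hsum.norm.tendsto_atTop_zero.bddAbove_range
  obtain ⟨M, hM⟩ := hb
  have hM' : ∀ n, ‖c n‖ * ρ ^ n ≤ M := fun n => by
    have := hM (Set.mem_range_self n)
    simpa [abs_of_pos hρ0] using this
  have hlt : ‖x‖ / ρ < 1 := (div_lt_one hρ0).mpr hxρ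
  have h0 : 0 ≤ ‖x‖ / ρ := by positivity
  have hg : Summable fun n : ℕ => ((n : ℝ) + 1) * (‖x‖ / ρ) ^ n := by
    have h1 := summable_pow_mul_geometric_of_norm_lt_one 1
      (show ‖(‖x‖ / ρ : ℝ)‖ < 1 by rwa [Real.norm_of_nonneg h0])
    have h2 := summable_geometric_of_lt_one h0 hlt
    refine (h1.add h2).congr fun n => ?_
    simp; ring
  refine Summable.of_nonneg_of_le (fun _ => norm_nonneg _) (fun n => ?_) (hg.mul_left (M / ρ))
  have hn : ‖(n : ℂ) + 1‖ = (n : ℝ) + 1 := by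
    have : ((n : ℂ) + 1) = ((n + 1 : ℕ) : ℂ) := by push_cast; rfl
    rw [this, Complex.norm_natCast]; push_cast; rfl
  rw [norm_mul, norm_mul, norm_pow, hn, div_pow]
  have h3 := hM' (n + 1)
  have : ‖c (n + 1)‖ ≤ M / ρ / ρ ^ n := by
    rw [div_div, ← pow_succ', le_div_iff₀ (by positivity)]; exact h3
  calc ((n : ℝ) + 1) * ‖c (n + 1)‖ * ‖x‖ ^ n ≤ (n + 1) * (M / ρ / ρ ^ n) * ‖x‖ ^ n := by gcongr
    _ = _ := by field_simp

theorem hasDerivAt_tsum_mul_pow {c : ℕ → ℂ} {r : ℝ}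
    (hc : ∀ x : ℂ, ‖x‖ < r → Summable fun n => c n * x ^ n) {x : ℂ} (hx : ‖x‖ < r) :
    HasDerivAt (fun z : ℂ => ∑' n, c n * z ^ n) (∑' n : ℕ, ((n : ℂ) + 1) * c (n + 1) * x ^ n) x := by
  obtain ⟨ρ, hxρ, hρr⟩ := exists_between hx
  have hρ0 : 0 < ρ := (norm_nonneg x).trans_lt hxρ
  have hρn : ‖(ρ : ℂ)‖ = ρ := by simp [abs_of_pos hρ0]
  have hs := summable_succ_mul_coeff hc (x := (ρ : ℂ)) (by rw [hρn]; exact hρr)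
  -- The truncated exponent at `n = 0` is harmless, because the factor `n` kills that term.
  have hu : Summable fun n : ℕ => ‖(n : ℂ) * c n * (ρ : ℂ) ^ (n - 1)‖ := by
    rw [← summable_nat_add_iff 1]
    simpa using hs
  have h := hasDerivAt_tsum_of_isPreconnected (𝕜 := ℂ)
    (g := fun (n : ℕ) (z : ℂ) => c n * z ^ n)
    (g' := fun (n : ℕ) (z : ℂ) => c n * ((n : ℂ) * z ^ (n - 1)))
    (t := Metric.ball (0 : ℂ) ρ) hu Metric.isOpen_ball
    (convex_ball (0 : ℂ) ρ).isPreconnected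
    (fun n y _ => (hasDerivAt_pow n y).const_mul (c n)) (fun n y hy => ?_)
    (y₀ := x) (y := x) (by simpa using hxρ) (hc x hx) (by simpa using hxρ)
  · refine h.congr_deriv ?_
    have hx' := (summable_succ_mul_coeff hc hx).of_norm
    have hsum : Summable fun n : ℕ => c n * ((n : ℂ) * x ^ (n - 1)) := by
      rw [← summable_nat_add_iff 1]
      refine hx'.congr fun n => ?_
      simp; ring
    rw [hsum.tsum_eq_zero_add]
    simp only [Nat.cast_zero, zero_mul, mul_zero, zero_add]
    refine tsum_congr fun n => ?_
    simp; ring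
  · have hy' : ‖y‖ ≤ ρ := by simpa using (mem_ball_zero_iff.mp hy).le
    rw [norm_mul, norm_mul, norm_mul, norm_mul, norm_pow, norm_pow, hρn]
    calc ‖c n‖ * (‖(n : ℂ)‖ * ‖y‖ ^ (n - 1)) ≤ ‖c n‖ * (‖(n : ℂ)‖ * ρ ^ (n - 1)) := by gcongr
      _ = _ := by ring

theorem iteratedDeriv_tsum_mul_pow {c : ℕ → ℂ} {r : ℝ}
    (hc : ∀ x : ℂ, ‖x‖ < r → Summable fun n => c n * x ^ n) (k : ℕ) {x : ℂ} (hx : ‖x‖ < r) :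
    iteratedDeriv k (fun z : ℂ => ∑' n, c n * z ^ n) x =
      ∑' n : ℕ, (((n + k).descFactorial k : ℕ) : ℂ) * c (n + k) * x ^ n := by
  induction k generalizing c x with
  | zero => simp
  | succ k ih =>
    rw [iteratedDeriv_succ']
    have hd : (deriv fun z : ℂ => ∑' n, c n * z ^ n) =ᶠ[nhds x]
        fun z => ∑' n : ℕ, ((n : ℂ) + 1) * c (n + 1) * z ^ n := by
      have hmem : Metric.ball (0 : ℂ) r ∈ nhds x :=
        Metric.isOpen_ball.mem_nhds (by simpa using hx)
      filter_upwards [hmem] with z hz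
      exact (hasDerivAt_tsum_mul_pow hc (by simpa using hz)).deriv
    rw [hd.iteratedDeriv_eq k,
      ih (c := fun n => ((n : ℂ) + 1) * c (n + 1))
        (fun y hy => (summable_succ_mul_coeff hc hy).of_norm) hx]
    refine tsum_congr fun n => ?_
    rw [show n + (k + 1) = (n + k) + 1 by ring, Nat.succ_descFactorial_succ]
    push_cast
    ring

theorem summable_descFactorial_mul_coeff {c : ℕ → ℂ} {r : ℝ}
    (hc : ∀ x : ℂ, ‖x‖ < r → Summable fun n => c n * x ^ n) (k : ℕ) {x : ℂ} (hx : ‖x‖ < r) :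
    Summable fun n : ℕ => (((n + k).descFactorial k : ℕ) : ℂ) * c (n + k) * x ^ n := by
  induction k generalizing c x with
  | zero => simpa using hc x hx
  | succ k ih =>
    refine (ih (c := fun n => ((n : ℂ) + 1) * c (n + 1))
      (fun y hy => (summable_succ_mul_coeff hc hy).of_norm) hx).congr fun n => ?_
    rw [show n + (k + 1) = (n + k) + 1 by ring, Nat.succ_descFactorial_succ]
    push_cast
    ring

/-- With `U`, `V` the sums of the two series, the formal identity `A' = L' A` becomes `U' = V' U` by
the Cauchy product. So `U exp(-V)` is constant on the disc, with value one at the origin. -/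
theorem IsExp.tsum_eq_exp {A L : PowerSeries ℝ} (h : IsExp A L)
    (hL0 : PowerSeries.constantCoeff L = 0) {r : ℝ}
    (hA : ∀ x : ℂ, ‖x‖ < r → Summable fun n => ((PowerSeries.coeff n A : ℝ) : ℂ) * x ^ n)
    (hL : ∀ x : ℂ, ‖x‖ < r → Summable fun n => ((PowerSeries.coeff n L : ℝ) : ℂ) * x ^ n)
    {x : ℂ} (hx : ‖x‖ < r) :
    ∑' n, ((PowerSeries.coeff n A : ℝ) : ℂ) * x ^ n =
      Complex.exp (∑' n, ((PowerSeries.coeff n L : ℝ) : ℂ) * x ^ n) := by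
  set U : ℂ → ℂ := fun z => ∑' n, ((PowerSeries.coeff n A : ℝ) : ℂ) * z ^ n with hU
  set V : ℂ → ℂ := fun z => ∑' n, ((PowerSeries.coeff n L : ℝ) : ℂ) * z ^ n with hV
  set V' : ℂ → ℂ := fun z =>
    ∑' n : ℕ, ((n : ℂ) + 1) * ((PowerSeries.coeff (n + 1) L : ℝ) : ℂ) * z ^ n with hV'
  have hdV : ∀ z : ℂ, ‖z‖ < r → HasDerivAt V (V' z) z := fun z hz =>
    hasDerivAt_tsum_mul_pow hL hz
  have hdU : ∀ z : ℂ, ‖z‖ < r → HasDerivAt U (V' z * U z) z := fun z hz => by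
    have h1 := hasDerivAt_tsum_mul_pow hA hz
    refine h1.congr_deriv ?_
    have hAn : Summable fun n => ‖((PowerSeries.coeff n A : ℝ) : ℂ) * z ^ n‖ := (hA z hz).norm
    rw [hV', hU]
    symm
    rw [tsum_mul_tsum_eq_tsum_sum_antidiagonal_of_summable_norm
      (summable_succ_mul_coeff hL hz) hAn]
    refine tsum_congr fun n => ?_
    have h2 := congrArg (fun t : ℝ => (t : ℂ)) (h.coeff_succ n)
    push_cast at h2
    rw [h2, Finset.sum_mul]
    refine Finset.sum_congr rfl fun p hp => ?_
    rw [← Finset.HasAntidiagonal.mem_antidiagonal.mp hp, pow_add]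
    ring
  have hr : 0 < r := (norm_nonneg x).trans_lt hx
  have hdW : ∀ z ∈ Metric.ball (0 : ℂ) r,
      HasDerivWithinAt (fun z => U z * Complex.exp (-V z)) 0 (Metric.ball (0 : ℂ) r) z := by
    intro z hz
    have hz' : ‖z‖ < r := by simpa using hz
    have h3 := (hdU z hz').mul ((hdV z hz').neg.cexp)
    refine (h3.congr_deriv ?_).hasDerivWithinAt
    ring
  have hconst := (convex_ball (0 : ℂ) r).is_const_of_fderivWithin_eq_zero (𝕜 := ℂ)
    (fun z hz => (hdW z hz).differentiableWithinAt)
    (fun z hz => by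
      have h4 := (hdW z hz).hasFDerivWithinAt.fderivWithin
        (Metric.isOpen_ball.uniqueDiffWithinAt hz)
      rw [h4]; ext; simp)
    (show x ∈ Metric.ball (0 : ℂ) r by simpa using hx)
    (show (0 : ℂ) ∈ Metric.ball (0 : ℂ) r by simpa using hr)
  have hz0 : ∀ c : ℕ → ℂ, ∑' n, c n * (0 : ℂ) ^ n = c 0 := fun c => by
    rw [tsum_eq_single 0 (fun n hn => by simp [hn])]; simp
  have hU0 : U 0 = 1 := by rw [hU]; simp only; rw [hz0]; simp [h.1]
  have hV0 : V 0 = 0 := by rw [hV]; simp only; rw [hz0]; simp [hL0]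
  simp only [hU0, hV0, neg_zero, Complex.exp_zero, mul_one] at hconst
  rw [Complex.exp_neg] at hconst
  have := Complex.exp_ne_zero (V x)
  field_simp at hconst
  exact hconst

end AnalyticPowerSeries

/-! ### Prime factorization of polynomials and the local form of `g(F) deg F`. -/

section LogDerivativeIdentity

variable {K : Type u} [Field K]

open scoped Classical in
open UniqueFactorizationMonoid in
theorem pow_dvd_iff_le_count {P F : K[X]} (hP : P.Monic) (hPi : Irreducible P)
    (hF : F ≠ 0) (k : ℕ) : P ^ k ∣ F ↔ k ≤ (normalizedFactors F).count P := by
  have h := emultiplicity_eq_count_normalizedFactors hPi hF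
  rw [hP.normalize_eq_self] at h
  rw [pow_dvd_iff_le_emultiplicity, h, Nat.cast_le]

open scoped Classical in
open UniqueFactorizationMonoid in
theorem sum_count_mul_natDegree {F : K[X]} (hF : F.Monic) (S : Finset K[X])
    (hS : ∀ P : K[X], P.Monic → Irreducible P → P.natDegree ≤ F.natDegree → P ∈ S) :
    ∑ P ∈ S, (normalizedFactors F).count P * P.natDegree = F.natDegree := by
  have hmon : ∀ P ∈ normalizedFactors F, P.Monic := fun P hP => by
    have h1 := normalize_normalized_factor P hP
    rw [← h1]
    exact Polynomial.monic_normalize (irreducible_of_normalized_factor P hP).ne_zero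
  have hprod : (normalizedFactors F).prod = F := by
    rw [prod_normalizedFactors_eq hF.ne_zero, hF.normalize_eq_self]
  have hdeg : ((normalizedFactors F).map natDegree).sum = F.natDegree := by
    conv_rhs => rw [← hprod]
    have := Polynomial.natDegree_multiset_prod_of_monic (normalizedFactors F) hmon
    rw [this]
  rw [← hdeg, Finset.sum_multiset_map_count]
  symm
  refine Finset.sum_subset_zero_on_sdiff ?_ ?_ ?_
  · intro P hP
    rw [Multiset.mem_toFinset] at hP
    refine hS P (hmon P hP) (irreducible_of_normalized_factor P hP) ?_
    exact natDegree_le_of_dvd (dvd_of_mem_normalizedFactors hP) hF.ne_zero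
  · intro P hP
    rw [Finset.mem_sdiff, Multiset.mem_toFinset] at hP
    rw [Multiset.count_eq_zero_of_notMem hP.2, zero_mul]
  · intro P _
    rw [smul_eq_mul]

open scoped Classical in
/-- The contribution of one prime to the identity `g F * deg F = ∑ Λ (P ^ k) * g (F / P ^ k)`. -/
theorem sum_pow_dvd_mul {g : K[X] → ℝ} {d b : ℕ → ℝ}
    (hg : IsMultiplicative g) (hd : HasPrimePowerValues g d)
    (hb : ∀ e : ℕ, (e : ℝ) * (if e = 0 then 1 else d e) =
      ∑ k ∈ Finset.Icc 1 e, b k * (if e - k = 0 then 1 else d (e - k)))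
    {F P : K[X]} (hF : F.Monic) (hP : P.Monic) (hPi : Irreducible P) {N : ℕ}
    (hN : F.natDegree ≤ N) :
    ∑ k ∈ (Finset.Icc 1 N).filter (fun k => P ^ k ∣ F), b k * g (F / P ^ k) =
      ((UniqueFactorizationMonoid.normalizedFactors F).count P : ℝ) * g F := by
  set e := (UniqueFactorizationMonoid.normalizedFactors F).count P with he
  have hiff := pow_dvd_iff_le_count hP hPi hF.ne_zero
  obtain ⟨H, hH⟩ := (hiff e).mpr le_rfl
  have hHm : H.Monic := (hP.pow e).of_mul_monic_left (hH ▸ hF)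
  have hPH : ¬ P ∣ H := fun ⟨Q, hQ⟩ => by
    have : P ^ (e + 1) ∣ F := ⟨Q, by rw [hH, hQ, pow_succ]; ring⟩
    have := (hiff (e + 1)).mp this
    omega
  have hcop : ∀ k : ℕ, IsCoprime (P ^ k) H := fun k =>
    (hPi.coprime_iff_not_dvd.mpr hPH).pow_left
  have hgk : ∀ k : ℕ, g (P ^ k * H) = (if k = 0 then 1 else d k) * g H := fun k => by
    rw [hg.2 _ _ (hP.pow k) hHm (hcop k)]
    split_ifs with h0
    · rw [h0, pow_zero, hg.1]
    · rw [hd P hP hPi k (Nat.one_le_iff_ne_zero.mpr h0)]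
  have heN : e ≤ N := by
    have h1 : (P ^ e).natDegree ≤ F.natDegree := natDegree_le_of_dvd ⟨H, hH⟩ hF.ne_zero
    rw [hP.natDegree_pow] at h1
    have h2 : 1 ≤ P.natDegree := hPi.natDegree_pos
    nlinarith
  have hset : (Finset.Icc 1 N).filter (fun k => P ^ k ∣ F) = Finset.Icc 1 e := by
    ext k
    rw [Finset.mem_filter, hiff, Finset.mem_Icc, Finset.mem_Icc, ← he]
    omega
  rw [hset]
  have hgF : g F = (if e = 0 then 1 else d e) * g H := by rw [hH, hgk]
  rw [hgF, ← mul_assoc, hb, Finset.sum_mul]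
  refine Finset.sum_congr rfl fun k hk => ?_
  have hke : k ≤ e := (Finset.mem_Icc.mp hk).2
  have hdiv : F / P ^ k = P ^ (e - k) * H := by
    rw [hH, ← Nat.sub_add_cancel hke, pow_add, Nat.add_sub_cancel,
      mul_comm (P ^ (e - k)), mul_assoc, mul_div_cancel_left₀ _ (pow_ne_zero _ hP.ne_zero)]
  rw [hdiv, hgk, mul_assoc]

end LogDerivativeIdentity

/-! ### The recursion for `T(N)` and the count of irreducible polynomials. -/

section Recursion

variable {K : Type u} [Field K] [Fintype K]

theorem finite_primesOfDegree (K : Type u) [Field K] [Fintype K] (l : ℕ) :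
    {P : K[X] | P.Monic ∧ Irreducible P ∧ P.natDegree = l}.Finite :=
  (finite_monicsOfDegree K l).subset fun _ hP => ⟨hP.1, hP.2.2⟩

/-- The monic irreducible polynomials of degree `l`, as a finset. -/
noncomputable def primesOfDegree (K : Type u) [Field K] [Fintype K] (l : ℕ) : Finset K[X] :=
  (finite_primesOfDegree K l).toFinset

theorem mem_primesOfDegree {l : ℕ} {P : K[X]} :
    P ∈ primesOfDegree K l ↔ P.Monic ∧ Irreducible P ∧ P.natDegree = l := by
  rw [primesOfDegree, Set.Finite.mem_toFinset, Set.mem_ofPred_eq]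

theorem card_primesOfDegree (l : ℕ) : (primesOfDegree K l).card = primeCount K l := by
  rw [primeCount, Set.ncard_eq_toFinset_card _ (finite_primesOfDegree K l), primesOfDegree]

theorem mem_monics {N : ℕ} {F : K[X]} :
    F ∈ (finite_monicsOfDegree K N).toFinset ↔ F.Monic ∧ F.natDegree = N := by
  rw [Set.Finite.mem_toFinset, monicsOfDegree, Set.mem_ofPred_eq]

open scoped Classical in
theorem sum_monics_div (g : K[X] → ℝ) {P : K[X]} (hP : P.Monic) (k N : ℕ) :
    ∑ F ∈ (finite_monicsOfDegree K N).toFinset.filter (fun F => P ^ k ∣ F), g (F / P ^ k) =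
      if k * P.natDegree ≤ N then T g (N - k * P.natDegree) else 0 := by
  have hPk : (P ^ k).Monic := hP.pow k
  have hdeg : (P ^ k).natDegree = k * P.natDegree := hP.natDegree_pow k
  split_ifs with h
  · rw [T]
    refine Finset.sum_bij' (fun F _ => F / P ^ k) (fun H _ => P ^ k * H) ?_ ?_ ?_ ?_ ?_
    · intro F hF
      obtain ⟨hF1, H, hH⟩ := Finset.mem_filter.mp hF
      rw [mem_monics] at hF1 ⊢
      have hHm : H.Monic := hPk.of_mul_monic_left (hH ▸ hF1.1)
      rw [hH, mul_div_cancel_left₀ _ hPk.ne_zero]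
      refine ⟨hHm, ?_⟩
      have := hF1.2
      rw [hH, hPk.natDegree_mul hHm, hdeg] at this
      omega
    · intro H hH
      rw [mem_monics] at hH
      rw [Finset.mem_filter, mem_monics]
      refine ⟨⟨hPk.mul hH.1, ?_⟩, dvd_mul_right _ _⟩
      rw [hPk.natDegree_mul hH.1, hdeg, hH.2]
      omega
    · intro F hF
      obtain ⟨_, H, hH⟩ := Finset.mem_filter.mp hF
      rw [hH, mul_div_cancel_left₀ _ hPk.ne_zero]
    · intro H _
      rw [mul_div_cancel_left₀ _ hPk.ne_zero]
    · intro F _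
      rfl
  · refine Finset.sum_eq_zero fun F hF => ?_
    obtain ⟨hF1, hdvd⟩ := Finset.mem_filter.mp hF
    rw [mem_monics] at hF1
    have := natDegree_le_of_dvd hdvd hF1.1.ne_zero
    omega

/-- `∑ l π(l) b(k)` over the factorizations `m = l k`. -/
noncomputable def primePowerSum (K : Type u) [Field K] (b : ℕ → ℝ) (m : ℕ) : ℝ :=
  ∑ p ∈ m.divisorsAntidiagonal, ((p.1 : ℝ) * (primeCount K p.1 : ℝ)) * b p.2

/-- The logarithmic derivative of the Euler product, done by finite counting. Split `N = deg F` into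
multiplicities times degrees of the primes of `F`, replace each multiplicity times `g F` by a sum
over prime powers `P^k ∣ F`, and exchange sums: the cofactors `F / P^k` run over all monics of
degree `N - k deg P`. -/
theorem natCast_mul_T {g : K[X] → ℝ} {d b : ℕ → ℝ}
    (hg : IsMultiplicative g) (hd : HasPrimePowerValues g d)
    (hb : ∀ e : ℕ, (e : ℝ) * (if e = 0 then 1 else d e) =
      ∑ k ∈ Finset.Icc 1 e, b k * (if e - k = 0 then 1 else d (e - k))) (N : ℕ) :
    (N : ℝ) * T g N = ∑ m ∈ Finset.Icc 1 N, primePowerSum K b m * T g (N - m) := by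
  classical
  set S : Finset K[X] := (Finset.Icc 1 N).biUnion (primesOfDegree K) with hS
  have hSmem : ∀ P ∈ S, P.Monic ∧ Irreducible P := fun P hP => by
    obtain ⟨l, _, hl⟩ := Finset.mem_biUnion.mp hP
    exact ⟨(mem_primesOfDegree.mp hl).1, (mem_primesOfDegree.mp hl).2.1⟩
  have hdisj : ((Finset.Icc 1 N : Finset ℕ) : Set ℕ).PairwiseDisjoint (primesOfDegree K) := by
    intro i _ j _ hij
    rw [Function.onFun, Finset.disjoint_left]
    intro P h1 h2
    exact hij ((mem_primesOfDegree.mp h1).2.2.symm.trans (mem_primesOfDegree.mp h2).2.2)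
  have h1 : (N : ℝ) * T g N = ∑ F ∈ (finite_monicsOfDegree K N).toFinset, ∑ P ∈ S,
      (P.natDegree : ℝ) * ∑ k ∈ (Finset.Icc 1 N).filter (fun k => P ^ k ∣ F),
        b k * g (F / P ^ k) := by
    rw [T, Finset.mul_sum]
    refine Finset.sum_congr rfl fun F hF => ?_
    obtain ⟨hFm, hFN⟩ := mem_monics.mp hF
    have h2 := sum_count_mul_natDegree hFm S (fun P hP hPi hle => by
      refine Finset.mem_biUnion.mpr ⟨P.natDegree, Finset.mem_Icc.mpr ⟨hPi.natDegree_pos, ?_⟩,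
        mem_primesOfDegree.mpr ⟨hP, hPi, rfl⟩⟩
      omega)
    have h3 : (N : ℝ) = ∑ P ∈ S,
        ((UniqueFactorizationMonoid.normalizedFactors F).count P : ℝ) * (P.natDegree : ℝ) := by
      rw [← hFN, ← h2]; push_cast; rfl
    rw [h3, Finset.sum_mul]
    refine Finset.sum_congr rfl fun P hP => ?_
    rw [sum_pow_dvd_mul hg hd hb hFm (hSmem P hP).1 (hSmem P hP).2 hFN.le]
    ring
  have h4 : ∀ P : K[X], P.Monic → ∑ F ∈ (finite_monicsOfDegree K N).toFinset,
      (P.natDegree : ℝ) * ∑ k ∈ (Finset.Icc 1 N).filter (fun k => P ^ k ∣ F),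
        b k * g (F / P ^ k) = ∑ k ∈ Finset.Icc 1 N, (P.natDegree : ℝ) * b k *
          (if k * P.natDegree ≤ N then T g (N - k * P.natDegree) else 0) := by
    intro P hP
    simp_rw [← sum_monics_div g hP, Finset.mul_sum, Finset.sum_filter]
    rw [Finset.sum_comm]
    refine Finset.sum_congr rfl fun k _ => Finset.sum_congr rfl fun F _ => ?_
    split_ifs <;> ring
  rw [h1, Finset.sum_comm, Finset.sum_congr rfl fun P hP => h4 P (hSmem P hP).1, hS,
    Finset.sum_biUnion hdisj]
  have h5 : ∀ l ∈ Finset.Icc 1 N, ∑ P ∈ primesOfDegree K l, ∑ k ∈ Finset.Icc 1 N,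
      (P.natDegree : ℝ) * b k *
        (if k * P.natDegree ≤ N then T g (N - k * P.natDegree) else 0) =
      ∑ k ∈ Finset.Icc 1 N, ((l : ℝ) * primeCount K l) * b k *
        (if l * k ≤ N then T g (N - l * k) else 0) := by
    intro l _
    rw [Finset.sum_congr rfl (g := fun _ => ∑ k ∈ Finset.Icc 1 N, (l : ℝ) * b k *
        (if l * k ≤ N then T g (N - l * k) else 0)), Finset.sum_const, card_primesOfDegree,
      nsmul_eq_mul, Finset.mul_sum]
    · exact Finset.sum_congr rfl fun k _ => by ring
    · intro P hP
      rw [(mem_primesOfDegree.mp hP).2.2]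
      exact Finset.sum_congr rfl fun k _ => by rw [mul_comm k l]
  rw [Finset.sum_congr rfl h5, ← Finset.sum_product']
  simp_rw [primePowerSum, Finset.sum_mul]
  rw [Finset.sum_sigma']
  simp_rw [mul_ite, mul_zero]
  rw [← Finset.sum_filter]
  -- Pairs (degree, exponent) are regrouped by their product `m`.
  refine Finset.sum_bij' (fun p _ => ⟨p.1 * p.2, p⟩) (fun s _ => s.2) ?_ ?_ ?_ ?_ ?_
  · rintro ⟨l, k⟩ h
    simp only [Finset.mem_filter, Finset.mem_product, Finset.mem_Icc] at h
    simp only [Finset.mem_sigma, Finset.mem_Icc, Nat.mem_divisorsAntidiagonal]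
    have h6 : 1 ≤ l * k := Nat.mul_pos h.1.1.1 h.1.2.1
    exact ⟨⟨h6, h.2⟩, trivial, by omega⟩
  · rintro ⟨m, l, k⟩ h
    simp only [Finset.mem_sigma, Finset.mem_Icc, Nat.mem_divisorsAntidiagonal] at h
    simp only [Finset.mem_filter, Finset.mem_product, Finset.mem_Icc]
    obtain ⟨⟨h7, h8⟩, h9, h10⟩ := h
    have hl : l ≠ 0 := by rintro rfl; simp at h9; omega
    have hk : k ≠ 0 := by rintro rfl; simp at h9; omega
    have h11 : l ≤ l * k := Nat.le_mul_of_pos_right l (Nat.pos_of_ne_zero hk)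
    have h12 : k ≤ l * k := Nat.le_mul_of_pos_left k (Nat.pos_of_ne_zero hl)
    omega
  · rintro ⟨l, k⟩ _
    rfl
  · rintro ⟨m, l, k⟩ h
    simp only [Finset.mem_sigma, Finset.mem_Icc, Nat.mem_divisorsAntidiagonal] at h
    obtain ⟨_, rfl, _⟩ := h
    rfl
  · rintro ⟨l, k⟩ _
    rfl

theorem card_monics (N : ℕ) :
    (finite_monicsOfDegree K N).toFinset.card = Fintype.card K ^ N := by
  have e : monicsOfDegree K N ≃ (Fin N → K) :=
    (monicEquivDegreeLT N).trans (degreeLTEquiv K N).toEquiv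
  rw [← Set.ncard_eq_toFinset_card _ (finite_monicsOfDegree K N), ← Nat.card_coe_set_eq,
    Nat.card_congr e, Nat.card_eq_fintype_card, Fintype.card_fun, Fintype.card_fin]

/-- `∑_{l ∣ m} l π(l) = q ^ m`. -/
theorem primePowerSum_one {m : ℕ} (hm : 1 ≤ m) :
    primePowerSum K (fun _ => 1) m = (Fintype.card K : ℝ) ^ m := by
  have hT : ∀ N, T (fun _ : K[X] => (1 : ℝ)) N = (Fintype.card K : ℝ) ^ N := fun N => by
    rw [T, Finset.sum_const, card_monics, nsmul_eq_mul, mul_one, Nat.cast_pow]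
  -- For `g = 1` the sums `T(N)` are just `q^N`. Under the induction hypothesis every term of the
  -- recursion with index below `m` equals `q^m`, which leaves `q^m` for the last one.
  have hrec := natCast_mul_T (K := K) (g := fun _ => (1 : ℝ)) (d := fun _ => 1)
    (b := fun _ => 1) ⟨rfl, fun _ _ _ _ _ => by norm_num⟩ (fun _ _ _ _ _ => rfl)
    (fun e => by simp)
  induction m using Nat.strong_induction_on with
  | _ m ih =>
    have h := hrec m
    obtain ⟨m, rfl⟩ : ∃ m', m = m' + 1 := ⟨m - 1, by omega⟩
    rw [Finset.sum_Icc_succ_top (by omega)] at h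
    rw [Finset.sum_congr rfl (g := fun _ => (Fintype.card K : ℝ) ^ (m + 1))] at h
    · rw [Finset.sum_const, Nat.card_Icc, hT, hT, Nat.sub_self, pow_zero, mul_one, nsmul_eq_mul,
        Nat.add_sub_cancel] at h
      push_cast at h
      linarith
    · intro j hj
      rw [Finset.mem_Icc] at hj
      rw [ih j (by omega) hj.1, hT, ← pow_add]
      congr 1
      omega

/-- The left side is the single term `(l, 1)` of the nonnegative sum in `primePowerSum_one`. -/
theorem natCast_mul_primeCount_le {l : ℕ} (hl : 1 ≤ l) :
    (l : ℝ) * primeCount K l ≤ (Fintype.card K : ℝ) ^ l := by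
  rw [← primePowerSum_one hl, primePowerSum]
  have hmem : (l, 1) ∈ l.divisorsAntidiagonal :=
    Nat.mem_divisorsAntidiagonal.mpr ⟨mul_one l, by omega⟩
  have := Finset.single_le_sum
    (f := fun p : ℕ × ℕ => ((p.1 : ℝ) * (primeCount K p.1 : ℝ)) * 1)
    (fun p _ => by positivity) hmem
  simpa using this

end Recursion

/-! ### The series `f`, its logarithm, and the deviation of `ln f(t)` from `-d₁ ln(1 - t)`. -/

section LogSeries

theorem isExp_fSeries (d : ℕ → ℝ) : IsExp (fSeries d) (PowerSeries.logOf (fSeries d)) :=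
  isExp_logOf (by
    rw [← PowerSeries.coeff_zero_eq_constantCoeff_apply, fSeries, PowerSeries.coeff_mk, if_pos rfl])

theorem logCoeff_zero (d : ℕ → ℝ) : logCoeff d 0 = 0 := by
  rw [logCoeff, PowerSeries.coeff_zero_eq_constantCoeff_apply]
  exact PowerSeries.constantCoeff_logOf (isExp_fSeries d).1

theorem sum_antidiagonal_eq_sum_Icc (F : ℕ → ℕ → ℝ) (n : ℕ) :
    ∑ p ∈ Finset.HasAntidiagonal.antidiagonal n, F (p.1 + 1) p.2 =
      ∑ k ∈ Finset.Icc 1 (n + 1), F k (n + 1 - k) := by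
  rw [Finset.Nat.sum_antidiagonal_eq_sum_range_succ_mk, Finset.range_eq_Ico,
    ← Finset.Ico_add_one_right_eq_Icc,
    ← Finset.sum_Ico_add' (fun k => F k (n + 1 - k)) 0 (n + 1) 1]
  refine Finset.sum_congr rfl fun k _ => ?_
  rw [Nat.add_sub_add_right]

/-- The relation `t f' = (t (ln f)') f` in coefficients; it supplies the weights `b k = k a_k`
needed by `natCast_mul_T`. -/
theorem natCast_mul_fSeries (d : ℕ → ℝ) (e : ℕ) :
    (e : ℝ) * (if e = 0 then 1 else d e) =
      ∑ k ∈ Finset.Icc 1 e, ((k : ℝ) * logCoeff d k) * (if e - k = 0 then 1 else d (e - k)) := by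
  cases e with
  | zero => simp
  | succ n =>
    have h := (isExp_fSeries d).coeff_succ n
    simp only [fSeries, PowerSeries.coeff_mk] at h
    rw [← sum_antidiagonal_eq_sum_Icc
      (fun k j => ((k : ℝ) * logCoeff d k) * (if j = 0 then 1 else d j))]
    rw [Nat.cast_succ, h]
    exact Finset.sum_congr rfl fun p _ => by rw [Nat.cast_succ]; rfl

theorem logCoeff_one (d : ℕ → ℝ) : logCoeff d 1 = d 1 := by
  have h := natCast_mul_fSeries d 1
  simpa using h.symm

/-- The assumption `k |a_k| ≤ 1` says that `ln f` is majorized by `-ln(1 - t)`, so `f` is majorized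
by this geometric series. -/
theorem isExp_geometric :
    IsExp (PowerSeries.mk fun _ => (1 : ℝ)) (PowerSeries.mk fun k => (1 : ℝ) / k) := by
  refine isExp_of_coeff_succ (by simp) fun n => ?_
  simp only [PowerSeries.coeff_mk]
  rw [Finset.sum_congr rfl (g := fun _ => (1 : ℝ))]
  · simp
  · intro p _
    have : (p.1 : ℝ) + 1 ≠ 0 := by positivity
    push_cast
    field_simp

variable {d : ℕ → ℝ}

theorem abs_logCoeff_le (ha : ∀ k : ℕ, 1 ≤ k → (k : ℝ) * |logCoeff d k| ≤ 1) (k : ℕ) :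
    |logCoeff d (k + 1)| ≤ 1 / ((k + 1 : ℕ) : ℝ) := by
  rw [le_div_iff₀ (by positivity), mul_comm]
  exact ha (k + 1) (by omega)

theorem abs_coeff_fSeries_le (ha : ∀ k : ℕ, 1 ≤ k → (k : ℝ) * |logCoeff d k| ≤ 1) (k : ℕ) :
    |PowerSeries.coeff k (fSeries d)| ≤ 1 := by
  have h := (isExp_fSeries d).abs_coeff_le isExp_geometric (fun n => ?_) k
  · simpa using h
  · rw [PowerSeries.coeff_mk]
    exact abs_logCoeff_le ha n

theorem summable_ofReal_mul_pow {c : ℕ → ℝ} {M : ℝ} (hc : ∀ n, |c n| ≤ M) {x : ℂ}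
    (hx : ‖x‖ < 1) : Summable fun n => ((c n : ℝ) : ℂ) * x ^ n := by
  refine Summable.of_norm_bounded ((summable_geometric_of_lt_one (norm_nonneg x) hx).mul_left M)
    fun n => ?_
  rw [norm_mul, norm_pow, Complex.norm_real, Real.norm_eq_abs]
  gcongr
  exact hc n

theorem summable_fSeries (ha : ∀ k : ℕ, 1 ≤ k → (k : ℝ) * |logCoeff d k| ≤ 1) {t : ℂ}
    (ht : ‖t‖ < 1) :
    Summable fun k : ℕ => ((PowerSeries.coeff k (fSeries d) : ℝ) : ℂ) * t ^ k :=
  summable_ofReal_mul_pow (abs_coeff_fSeries_le ha) ht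

theorem summable_logCoeff (ha : ∀ k : ℕ, 1 ≤ k → (k : ℝ) * |logCoeff d k| ≤ 1) {t : ℂ}
    (ht : ‖t‖ < 1) : Summable fun k : ℕ => ((logCoeff d k : ℝ) : ℂ) * t ^ k := by
  refine summable_ofReal_mul_pow (M := 1) (fun n => ?_) ht
  cases n with
  | zero => rw [logCoeff_zero, abs_zero]; exact zero_le_one
  | succ n =>
    refine (abs_logCoeff_le ha n).trans ?_
    rw [div_le_one (by positivity)]
    exact_mod_cast Nat.succ_le_succ (Nat.zero_le n)

theorem f_eq_exp (ha : ∀ k : ℕ, 1 ≤ k → (k : ℝ) * |logCoeff d k| ≤ 1) {t : ℂ}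
    (ht : ‖t‖ < 1) : f d t = Complex.exp (∑' k : ℕ, ((logCoeff d k : ℝ) : ℂ) * t ^ k) :=
  (isExp_fSeries d).tsum_eq_exp (PowerSeries.constantCoeff_logOf (isExp_fSeries d).1) (fun _ h => summable_fSeries ha h)
    (fun _ h => summable_logCoeff ha h) ht

/-- The function `k ↦ k a_k - d₁` measuring how far `ln f(t)` is from `-d₁ ln (1 - t)`. -/
noncomputable def excess (d : ℕ → ℝ) (k : ℕ) : ℝ := (k : ℝ) * logCoeff d k - d 1

/-- This cancellation is the purpose of the factor `(1 - x^l)^(d₁)`: it widens the disc from radius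
`1/q` to `1/√q`. -/
theorem excess_one (d : ℕ → ℝ) : excess d 1 = 0 := by
  rw [excess, logCoeff_one]; simp

theorem abs_excess_le (h0 : 0 < d 1) (h1 : d 1 < 1)
    (ha : ∀ k : ℕ, 1 ≤ k → (k : ℝ) * |logCoeff d k| ≤ 1) (k : ℕ) : |excess d k| ≤ 2 := by
  rw [excess]
  have h2 : |(k : ℝ) * logCoeff d k| ≤ 1 := by
    rw [abs_mul, Nat.abs_cast]
    rcases Nat.eq_zero_or_pos k with rfl | hk
    · simp
    · exact ha k hk
  rw [abs_le] at h2 ⊢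
  constructor <;> linarith

theorem hasSum_excess (ha : ∀ k : ℕ, 1 ≤ k → (k : ℝ) * |logCoeff d k| ≤ 1)
    {t : ℂ} (ht : ‖t‖ < 1) :
    HasSum (fun k : ℕ => ((excess d k / k : ℝ) : ℂ) * t ^ k)
      ((∑' k : ℕ, ((logCoeff d k : ℝ) : ℂ) * t ^ k) + Complex.log (1 - t) * ((d 1 : ℝ) : ℂ)) := by
  have h1 := (summable_logCoeff ha ht).hasSum
  have h2 := (Complex.hasSum_taylorSeries_neg_log ht).mul_left (-((d 1 : ℝ) : ℂ))
  have h3 := h1.add h2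
  rw [show -((d 1 : ℝ) : ℂ) * -Complex.log (1 - t) = Complex.log (1 - t) * ((d 1 : ℝ) : ℂ) by
    ring] at h3
  convert h3 using 2 with k
  rcases Nat.eq_zero_or_pos k with rfl | hk
  · simp [logCoeff_zero]
  · have hk' : (k : ℂ) ≠ 0 := by exact_mod_cast hk.ne'
    rw [excess]
    push_cast
    field_simp
    ring

theorem f_mul_cpow_eq_exp (ha : ∀ k : ℕ, 1 ≤ k → (k : ℝ) * |logCoeff d k| ≤ 1)
    {t : ℂ} (ht : ‖t‖ < 1) :
    f d t * (1 - t) ^ ((d 1 : ℝ) : ℂ) =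
      Complex.exp (∑' k : ℕ, ((excess d k / k : ℝ) : ℂ) * t ^ k) := by
  have hne : 1 - t ≠ 0 := fun h => by
    rw [sub_eq_zero] at h
    rw [← h, norm_one] at ht
    exact lt_irrefl _ ht
  rw [f_eq_exp ha ht, Complex.cpow_def_of_ne_zero hne, ← Complex.exp_add,
    (hasSum_excess ha ht).tsum_eq]

end LogSeries

/-! ### Coefficient bounds for `a` and convergence of the Euler product. -/

section EulerProduct

variable {K : Type u} [Field K] [Fintype K]

theorem two_le_card (K : Type u) [Field K] [Fintype K] : (2 : ℝ) ≤ Fintype.card K := by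
  exact_mod_cast Fintype.one_lt_card (α := K)

theorem one_le_sqrt_card (K : Type u) [Field K] [Fintype K] :
    1 ≤ Real.sqrt (Fintype.card K) :=
  Real.one_le_sqrt.mpr (by linarith [two_le_card K])

theorem sum_range_pow_le {q : ℝ} (hq : 2 ≤ q) (n : ℕ) :
    ∑ l ∈ Finset.range (n + 1), q ^ l ≤ 2 * q ^ n := by
  induction n with
  | zero => simp
  | succ n ih =>
    rw [Finset.sum_range_succ, pow_succ]
    have : 0 < q ^ n := by positivity
    nlinarith

theorem pow_half_le_sqrt_pow {q : ℝ} (hq : 1 ≤ q) (m : ℕ) : q ^ (m / 2) ≤ Real.sqrt q ^ m := by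
  calc q ^ (m / 2) = Real.sqrt q ^ (2 * (m / 2)) := by
        rw [pow_mul, Real.sq_sqrt (by linarith)]
    _ ≤ Real.sqrt q ^ m := pow_le_pow_right₀ (Real.one_le_sqrt.mpr hq) (Nat.mul_div_le m 2)

/-- Since `b 1 = 0`, only factorizations `m = l k` with `k ≥ 2` matter, so `l ≤ m / 2`. With `l π(l)
≤ q^l` the sum is dominated by a geometric one with top term `q^(m/2)`. -/
theorem primePowerSum_le {b : ℕ → ℝ} (hb1 : b 1 = 0) (hb : ∀ k, b k ≤ 2) (m : ℕ) :
    primePowerSum K b m ≤ 4 * Real.sqrt (Fintype.card K) ^ m := by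
  have hq := two_le_card K
  set q : ℝ := (Fintype.card K : ℝ)
  have h1 : primePowerSum K b m ≤
      ∑ p ∈ m.divisorsAntidiagonal, if p.1 ≤ m / 2 then 2 * q ^ p.1 else 0 := by
    refine Finset.sum_le_sum fun p hp => ?_
    obtain ⟨hpm, hm0⟩ := Nat.mem_divisorsAntidiagonal.mp hp
    have hp1 : p.1 ≠ 0 := fun h => hm0 (by rw [← hpm, h, zero_mul])
    have hp2 : p.2 ≠ 0 := fun h => hm0 (by rw [← hpm, h, mul_zero])
    have hc := natCast_mul_primeCount_le (K := K) (Nat.one_le_iff_ne_zero.mpr hp1)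
    have hc0 : 0 ≤ (p.1 : ℝ) * primeCount K p.1 := by positivity
    split_ifs with h
    · nlinarith [hb p.2]
    · have : p.2 = 1 := by
        by_contra hne
        have h2 : 2 ≤ p.2 := by omega
        have : p.1 * 2 ≤ m := by rw [← hpm]; exact Nat.mul_le_mul_left _ h2
        omega
      rw [this, hb1, mul_zero]
  refine h1.trans ?_
  rw [Nat.sum_divisorsAntidiagonal (f := fun i _ => if i ≤ m / 2 then 2 * q ^ i else 0),
    ← Finset.sum_filter]
  calc ∑ i ∈ m.divisors.filter (fun i => i ≤ m / 2), 2 * q ^ i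
      ≤ ∑ i ∈ Finset.range (m / 2 + 1), 2 * q ^ i := by
        refine Finset.sum_le_sum_of_subset_of_nonneg (fun i hi => ?_) fun i _ _ => by positivity
        have := (Finset.mem_filter.mp hi).2
        rw [Finset.mem_range]; omega
    _ = 2 * ∑ i ∈ Finset.range (m / 2 + 1), q ^ i := by rw [Finset.mul_sum]
    _ ≤ 2 * (2 * q ^ (m / 2)) := by gcongr; exact sum_range_pow_le hq _
    _ ≤ 4 * Real.sqrt q ^ m := by
        have := pow_half_le_sqrt_pow (show 1 ≤ q by linarith) m
        linarith

omit [Fintype K] in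
theorem abs_primePowerSum_le {b : ℕ → ℝ} (m : ℕ) :
    |primePowerSum K b m| ≤ primePowerSum K (fun k => |b k|) m := by
  refine (Finset.abs_sum_le_sum_abs _ _).trans (Finset.sum_le_sum fun p _ => ?_)
  rw [abs_mul, abs_of_nonneg (by positivity)]

/-- The logarithm of `a` as a formal power series. -/
noncomputable def logSeries (K : Type u) [Field K] (d : ℕ → ℝ) : PowerSeries ℝ :=
  PowerSeries.mk fun m => primePowerSum K (excess d) m / m

omit [Fintype K] in
theorem constantCoeff_logSeries (d : ℕ → ℝ) : PowerSeries.constantCoeff (logSeries K d) = 0 := by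
  rw [← PowerSeries.coeff_zero_eq_constantCoeff_apply, logSeries, PowerSeries.coeff_mk]
  simp

/-- The formal power series of `a`. -/
noncomputable def aSeries (K : Type u) [Field K] (d : ℕ → ℝ) : PowerSeries ℝ :=
  (PowerSeries.exp ℝ).subst (logSeries K d)

omit [Fintype K] in
theorem isExp_aSeries (d : ℕ → ℝ) : IsExp (aSeries K d) (logSeries K d) :=
  isExp_exp_subst (constantCoeff_logSeries d)

/-- These are the coefficients of `(1 - s x)^(-4)` and of its logarithm. With `s = √q` this is the
majorant of `a`; the exponent `4` is the constant in `primePowerSum_le`. -/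
theorem isExp_pow_mul_choose (s : ℝ) :
    IsExp (PowerSeries.mk fun m => s ^ m * ((m + 3).choose 3 : ℕ))
      (PowerSeries.mk fun m => 4 * s ^ m / m) := by
  refine isExp_of_coeff_succ (by simp) fun n => ?_
  simp only [PowerSeries.coeff_mk]
  rw [Finset.sum_congr rfl (g := fun p : ℕ × ℕ => 4 * s ^ (n + 1) * ((p.2 + 3).choose 3 : ℕ))]
  · have h1 : ∀ n : ℕ, ∑ p ∈ Finset.HasAntidiagonal.antidiagonal n, (p.2 + 3).choose 3 =
        (n + 4).choose 4 := fun n => by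
      rw [Finset.Nat.sum_antidiagonal_eq_sum_range_succ (fun _ j => (j + 3).choose 3),
        Finset.sum_flip (fun j => (j + 3).choose 3)]
      exact Nat.sum_range_add_choose n 3
    have h2 := Nat.choose_succ_right_eq (n + 4) 3
    rw [show n + 4 - 3 = n + 1 by omega] at h2
    have h3 : ((n + 4).choose 4 : ℝ) * 4 = ((n + 4).choose 3 : ℝ) * ((n : ℝ) + 1) := by
      exact_mod_cast h2
    rw [← Finset.mul_sum, ← Nat.cast_sum, h1, show n + 1 + 3 = n + 4 by ring]
    linear_combination (-(s ^ (n + 1))) * h3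
  · intro p hp
    rw [← Finset.HasAntidiagonal.mem_antidiagonal.mp hp]
    have : (p.1 : ℝ) + 1 ≠ 0 := by positivity
    push_cast
    field_simp
    ring

variable {d : ℕ → ℝ}

theorem primePowerSum_abs_excess_le (h0 : 0 < d 1) (h1 : d 1 < 1)
    (ha : ∀ k : ℕ, 1 ≤ k → (k : ℝ) * |logCoeff d k| ≤ 1) (m : ℕ) :
    primePowerSum K (fun k => |excess d k|) m ≤ 4 * Real.sqrt (Fintype.card K) ^ m :=
  primePowerSum_le (by rw [excess_one, abs_zero]) (abs_excess_le h0 h1 ha) m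

theorem abs_coeff_logSeries_le (h0 : 0 < d 1) (h1 : d 1 < 1)
    (ha : ∀ k : ℕ, 1 ≤ k → (k : ℝ) * |logCoeff d k| ≤ 1) (m : ℕ) :
    |PowerSeries.coeff m (logSeries K d)| ≤ 4 * Real.sqrt (Fintype.card K) ^ m / m := by
  rw [logSeries, PowerSeries.coeff_mk, abs_div, Nat.abs_cast]
  gcongr
  exact (abs_primePowerSum_le m).trans (primePowerSum_abs_excess_le h0 h1 ha m)

theorem abs_coeff_aSeries_le (h0 : 0 < d 1) (h1 : d 1 < 1)
    (ha : ∀ k : ℕ, 1 ≤ k → (k : ℝ) * |logCoeff d k| ≤ 1) (m : ℕ) :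
    |PowerSeries.coeff m (aSeries K d)| ≤
      Real.sqrt (Fintype.card K) ^ m * ((m + 3).choose 3 : ℕ) := by
  have h := (isExp_aSeries (K := K) d).abs_coeff_le
    (isExp_pow_mul_choose (Real.sqrt (Fintype.card K))) (fun n => ?_) m
  · rwa [PowerSeries.coeff_mk] at h
  · rw [PowerSeries.coeff_mk]
    exact abs_coeff_logSeries_le h0 h1 ha (n + 1)

theorem sqrt_card_mul_norm_lt {x : ℂ} (hx : ‖x‖ < 1 / Real.sqrt (Fintype.card K)) :
    Real.sqrt (Fintype.card K) * ‖x‖ < 1 := by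
  rw [lt_div_iff₀ (by linarith [one_le_sqrt_card K])] at hx
  linarith

theorem norm_lt_one {x : ℂ} (hx : ‖x‖ < 1 / Real.sqrt (Fintype.card K)) : ‖x‖ < 1 := by
  have := sqrt_card_mul_norm_lt hx
  nlinarith [one_le_sqrt_card K, norm_nonneg x]

theorem summable_aSeries (h0 : 0 < d 1) (h1 : d 1 < 1)
    (ha : ∀ k : ℕ, 1 ≤ k → (k : ℝ) * |logCoeff d k| ≤ 1) (x : ℂ)
    (hx : ‖x‖ < 1 / Real.sqrt (Fintype.card K)) :
    Summable fun m => ((PowerSeries.coeff m (aSeries K d) : ℝ) : ℂ) * x ^ m := by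
  have hy := sqrt_card_mul_norm_lt hx
  set y := Real.sqrt (Fintype.card K) * ‖x‖ with hy'
  have hy0 : 0 ≤ y := by positivity
  have hs := summable_choose_mul_geometric_of_norm_lt_one (R := ℝ) 3
    (show ‖y‖ < 1 by rwa [Real.norm_of_nonneg hy0])
  refine Summable.of_norm_bounded hs fun m => ?_
  rw [norm_mul, norm_pow, Complex.norm_real, Real.norm_eq_abs]
  calc _ ≤ (Real.sqrt (Fintype.card K) ^ m * ((m + 3).choose 3 : ℕ)) * ‖x‖ ^ m := by
        gcongr
        exact abs_coeff_aSeries_le h0 h1 ha m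
    _ = _ := by rw [hy', mul_pow]; ring

theorem norm_logSeries_term_le (h0 : 0 < d 1) (h1 : d 1 < 1)
    (ha : ∀ k : ℕ, 1 ≤ k → (k : ℝ) * |logCoeff d k| ≤ 1) (x : ℂ) (m : ℕ) :
    ‖((PowerSeries.coeff m (logSeries K d) : ℝ) : ℂ) * x ^ m‖ ≤
      4 * (Real.sqrt (Fintype.card K) * ‖x‖) ^ m := by
  rw [norm_mul, norm_pow, Complex.norm_real, Real.norm_eq_abs, mul_pow, ← mul_assoc]
  gcongr
  refine (abs_coeff_logSeries_le h0 h1 ha m).trans ?_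
  rcases Nat.eq_zero_or_pos m with rfl | hm
  · simp
  · exact div_le_self (by positivity) (by exact_mod_cast hm)

theorem summable_logSeries (h0 : 0 < d 1) (h1 : d 1 < 1)
    (ha : ∀ k : ℕ, 1 ≤ k → (k : ℝ) * |logCoeff d k| ≤ 1) (x : ℂ)
    (hx : ‖x‖ < 1 / Real.sqrt (Fintype.card K)) :
    Summable fun m => ((PowerSeries.coeff m (logSeries K d) : ℝ) : ℂ) * x ^ m :=
  Summable.of_norm_bounded
    ((summable_geometric_of_lt_one (by positivity) (sqrt_card_mul_norm_lt hx)).mul_left 4)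
    (norm_logSeries_term_le h0 h1 ha x)

/-- The terms of the double series for `log a`. -/
noncomputable def logTerm (K : Type u) [Field K] (d : ℕ → ℝ) (x : ℂ) (p : ℕ × ℕ) : ℂ :=
  (primeCount K p.1 : ℂ) * (((excess d p.2 / p.2 : ℝ) : ℂ) * (x ^ p.1) ^ p.2)

omit [Fintype K] in
theorem factor_eq_exp (ha : ∀ k : ℕ, 1 ≤ k → (k : ℝ) * |logCoeff d k| ≤ 1) {x : ℂ}
    (hx : ‖x‖ < 1) {l : ℕ} (hl : l ≠ 0) :
    factor K d l x = Complex.exp (∑' k : ℕ+, logTerm K d x (l, k)) := by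
  have hxl : ‖x ^ l‖ < 1 := by
    rw [norm_pow]; exact pow_lt_one₀ (norm_nonneg x) hx hl
  have hs : Summable fun k : ℕ => logTerm K d x (l, k) :=
    (hasSum_excess ha hxl).summable.mul_left (primeCount K l : ℂ)
  -- Division by zero gives zero here, so including or dropping `k = 0` makes no difference.
  have hz : logTerm K d x (l, 0) = 0 := by
    rw [logTerm, Nat.cast_zero, div_zero, Complex.ofReal_zero, zero_mul, mul_zero]
  have h := tsum_zero_pnat_eq_tsum_nat hs
  rw [hz, zero_add] at h
  rw [h, factor, f_mul_cpow_eq_exp ha hxl, ← Complex.exp_nat_mul, ← tsum_mul_left]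
  rfl

omit [Fintype K] in
theorem sum_logTerm_fiber (x : ℂ) (m : ℕ+) :
    ∑ p ∈ (m : ℕ).divisorsAntidiagonal, logTerm K d x p =
      ((PowerSeries.coeff (m : ℕ) (logSeries K d) : ℝ) : ℂ) * x ^ (m : ℕ) := by
  rw [logSeries, PowerSeries.coeff_mk, primePowerSum, Finset.sum_div, Complex.ofReal_sum,
    Finset.sum_mul]
  refine Finset.sum_congr rfl fun p hp => ?_
  obtain ⟨hpm, hm0⟩ := Nat.mem_divisorsAntidiagonal.mp hp
  have hp1 : (p.1 : ℂ) ≠ 0 := fun h => hm0 (by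
    rw [← hpm, Nat.cast_eq_zero.mp h, zero_mul])
  have hp2 : (p.2 : ℂ) ≠ 0 := fun h => hm0 (by
    rw [← hpm, Nat.cast_eq_zero.mp h, mul_zero])
  rw [← hpm, logTerm, ← pow_mul]
  push_cast
  field_simp

omit [Fintype K] in
theorem sum_norm_logTerm_fiber (x : ℂ) (m : ℕ+) :
    ∑ p ∈ (m : ℕ).divisorsAntidiagonal, ‖logTerm K d x p‖ =
      primePowerSum K (fun k => |excess d k|) m / (m : ℕ) * ‖x‖ ^ (m : ℕ) := by
  rw [primePowerSum, Finset.sum_div, Finset.sum_mul]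
  refine Finset.sum_congr rfl fun p hp => ?_
  obtain ⟨hpm, hm0⟩ := Nat.mem_divisorsAntidiagonal.mp hp
  have hp1 : (p.1 : ℝ) ≠ 0 := fun h => hm0 (by
    rw [← hpm, Nat.cast_eq_zero.mp h, zero_mul])
  have hp2 : (p.2 : ℝ) ≠ 0 := fun h => hm0 (by
    rw [← hpm, Nat.cast_eq_zero.mp h, mul_zero])
  rw [← hpm, logTerm, ← pow_mul, norm_mul, norm_mul, norm_pow, Complex.norm_natCast,
    Complex.norm_real, Real.norm_eq_abs, abs_div, Nat.abs_cast]
  push_cast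
  field_simp

/-- Absolute convergence, tested along the fibres `l k = m`: the bound on `primePowerSum` applies to
`|excess|` as well, so the fibre sums are dominated by a geometric series of ratio `√q ‖x‖`. -/
theorem summable_logTerm (h0 : 0 < d 1) (h1 : d 1 < 1)
    (ha : ∀ k : ℕ, 1 ≤ k → (k : ℝ) * |logCoeff d k| ≤ 1) {x : ℂ}
    (hx : ‖x‖ < 1 / Real.sqrt (Fintype.card K)) :
    Summable fun s : (Σ n : ℕ+, (n : ℕ).divisorsAntidiagonal) =>
      logTerm K d x (s.2 : ℕ × ℕ) := by
  refine Summable.of_norm ?_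
  rw [summable_sigma_of_nonneg (fun _ => norm_nonneg _)]
  refine ⟨fun m => (hasSum_fintype _).summable, ?_⟩
  have hg : Summable fun m : ℕ+ => 4 * (Real.sqrt (Fintype.card K) * ‖x‖) ^ (m : ℕ) :=
    ((summable_geometric_of_lt_one (by positivity) (sqrt_card_mul_norm_lt hx)).mul_left
      4).comp_injective PNat.coe_injective
  refine Summable.of_nonneg_of_le (fun m => tsum_nonneg fun _ => norm_nonneg _) (fun m => ?_) hg
  rw [tsum_fintype]
  rw [Finset.sum_coe_sort (m : ℕ).divisorsAntidiagonal (fun p => ‖logTerm K d x p‖),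
    sum_norm_logTerm_fiber, mul_pow, ← mul_assoc]
  gcongr
  refine (div_le_self ?_ ?_).trans (primePowerSum_abs_excess_le h0 h1 ha m)
  · exact Finset.sum_nonneg fun p _ => by positivity
  · exact_mod_cast m.2

/-- The absolutely convergent double series for `log a` is summed in two ways: over `l k = m` it
gives the power series, over `k` first it gives the logarithms of the factors. Exponentiating turns
the outer sum into the product. -/
theorem hasProd_factor (h0 : 0 < d 1) (h1 : d 1 < 1)
    (ha : ∀ k : ℕ, 1 ≤ k → (k : ℝ) * |logCoeff d k| ≤ 1) {x : ℂ}
    (hx : ‖x‖ < 1 / Real.sqrt (Fintype.card K)) :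
    HasProd (fun l : ℕ => factor K d (l + 1) x)
      (Complex.exp (∑' m, ((PowerSeries.coeff m (logSeries K d) : ℝ) : ℂ) * x ^ m)) := by
  have hs := summable_logTerm h0 h1 ha hx
  have htot : ∑' s : (Σ n : ℕ+, (n : ℕ).divisorsAntidiagonal), logTerm K d x (s.2 : ℕ × ℕ) =
      ∑' m, ((PowerSeries.coeff m (logSeries K d) : ℝ) : ℂ) * x ^ m := by
    rw [hs.tsum_sigma, ← tsum_zero_pnat_eq_tsum_nat (summable_logSeries h0 h1 ha x hx),
      PowerSeries.coeff_zero_eq_constantCoeff_apply, constantCoeff_logSeries]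
    simp only [Complex.ofReal_zero, zero_mul, zero_add]
    refine tsum_congr fun m => ?_
    rw [tsum_fintype,
      Finset.sum_coe_sort (m : ℕ).divisorsAntidiagonal (fun p => logTerm K d x p),
      sum_logTerm_fiber]
  have hprod : HasSum (fun p : ℕ+ × ℕ+ => logTerm K d x (p.1, p.2))
      (∑' m, ((PowerSeries.coeff m (logSeries K d) : ℝ) : ℂ) * x ^ m) := by
    rw [← htot, ← sigmaAntidiagonalEquivProd.hasSum_iff]
    exact hs.hasSum
  have hl := (hprod.prod_fiberwise fun l => (hprod.summable.prod_factor l).hasSum).cexp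
  rw [← Equiv.pnatEquivNat.symm.hasProd_iff] at hl
  convert hl using 1
  funext l
  simp only [Function.comp_apply, Equiv.pnatEquivNat_symm_apply, Nat.succPNat_coe]
  rw [factor_eq_exp ha (norm_lt_one hx) (Nat.succ_ne_zero l)]

theorem a_eq_exp (h0 : 0 < d 1) (h1 : d 1 < 1)
    (ha : ∀ k : ℕ, 1 ≤ k → (k : ℝ) * |logCoeff d k| ≤ 1) {x : ℂ}
    (hx : ‖x‖ < 1 / Real.sqrt (Fintype.card K)) :
    a K d x = Complex.exp (∑' m, ((PowerSeries.coeff m (logSeries K d) : ℝ) : ℂ) * x ^ m) :=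
  (hasProd_factor h0 h1 ha hx).tprod_eq

theorem a_eq_tsum (h0 : 0 < d 1) (h1 : d 1 < 1)
    (ha : ∀ k : ℕ, 1 ≤ k → (k : ℝ) * |logCoeff d k| ≤ 1) {x : ℂ}
    (hx : ‖x‖ < 1 / Real.sqrt (Fintype.card K)) :
    a K d x = ∑' m, ((PowerSeries.coeff m (aSeries K d) : ℝ) : ℂ) * x ^ m := by
  rw [a_eq_exp h0 h1 ha hx]
  exact ((isExp_aSeries d).tsum_eq_exp (constantCoeff_logSeries d)
    (summable_aSeries h0 h1 ha) (summable_logSeries h0 h1 ha) hx).symm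

theorem differentiableOn_a (h0 : 0 < d 1) (h1 : d 1 < 1)
    (ha : ∀ k : ℕ, 1 ≤ k → (k : ℝ) * |logCoeff d k| ≤ 1) :
    DifferentiableOn ℂ (a K d) (Metric.ball (0 : ℂ) (1 / Real.sqrt (Fintype.card K))) := by
  have h : DifferentiableOn ℂ
      (fun x : ℂ => ∑' m, ((PowerSeries.coeff m (aSeries K d) : ℝ) : ℂ) * x ^ m)
      (Metric.ball (0 : ℂ) (1 / Real.sqrt (Fintype.card K))) := fun x hx =>
    (hasDerivAt_tsum_mul_pow (summable_aSeries h0 h1 ha)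
      (mem_ball_zero_iff.mp hx)).differentiableAt.differentiableWithinAt
  exact h.congr fun x hx => a_eq_tsum h0 h1 ha (mem_ball_zero_iff.mp hx)

end EulerProduct

/-! ### Coefficients of `(1 - y)^(s - d)`: identities and uniform bounds. -/

section Multichoose

theorem succ_mul_multichoose_succ (r : ℝ) (j : ℕ) :
    ((j : ℝ) + 1) * Ring.multichoose r (j + 1) = (r + j) * Ring.multichoose r j := by
  have h : ∀ n : ℕ, (n.factorial : ℝ) * Ring.multichoose r n = (ascPochhammer ℝ n).eval r :=
    fun n => by
      rw [← nsmul_eq_mul, Ring.factorial_nsmul_multichoose_eq_ascPochhammer,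
        Polynomial.ascPochhammer_smeval_eq_eval]
  have h1 := h (j + 1)
  rw [ascPochhammer_succ_eval, ← h j, Nat.factorial_succ] at h1
  push_cast at h1
  have hj : (j.factorial : ℝ) ≠ 0 := by exact_mod_cast Nat.factorial_ne_zero j
  refine mul_left_cancel₀ hj ?_
  linear_combination h1

theorem multichoose_sub_one_succ (r : ℝ) (j : ℕ) :
    Ring.multichoose (r - 1) (j + 1) = Ring.multichoose r (j + 1) - Ring.multichoose r j := by
  have h := Ring.multichoose_succ_succ (r - 1) j
  rw [sub_add_cancel] at h
  linarith

theorem succ_mul_multichoose_sub_one_succ (r : ℝ) (j : ℕ) :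
    ((j : ℝ) + 1) * Ring.multichoose (r - 1) (j + 1) = (r - 1) * Ring.multichoose r j := by
  rw [multichoose_sub_one_succ, mul_sub, succ_mul_multichoose_succ]
  ring

theorem multichoose_pos {r : ℝ} (hr : 0 < r) (j : ℕ) : 0 < Ring.multichoose r j := by
  induction j with
  | zero => rw [Ring.multichoose_zero_right]; exact one_pos
  | succ j ih =>
    have h := succ_mul_multichoose_succ r j
    have h1 : 0 < (r + j) * Ring.multichoose r j := by positivity
    rw [← h] at h1
    exact pos_of_mul_pos_right h1 (by positivity)

theorem neg_one_pow_mul_choose_neg (r : ℝ) (j : ℕ) :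
    (-1 : ℝ) ^ j * Ring.choose (-r) j = Ring.multichoose r j := by
  rw [Ring.choose_neg', Units.smul_def, zsmul_eq_mul, ← mul_assoc]
  have : (-1 : ℝ) ^ j * ((Int.negOnePow j : ℤˣ) : ℤ) = 1 := by
    rcases Nat.even_or_odd j with h | h
    · rw [h.neg_one_pow, Int.negOnePow_even _ (by exact_mod_cast h)]; simp
    · rw [h.neg_one_pow, Int.negOnePow_odd _ (by exact_mod_cast h)]; simp
  rw [this, one_mul]

/-- Coefficient extraction from `(1 - y) ^ (k - d)` in terms of binomial quotients. -/
theorem multichoose_sub_mul (d : ℝ) (k N : ℕ) (hN : 1 ≤ N) :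
    (-1 : ℝ) ^ k * Ring.multichoose (d - k) N * Ring.multichoose ((N : ℝ) + d - k) k =
      Ring.multichoose d N * Ring.multichoose (1 - d) k := by
  obtain ⟨j, rfl⟩ : ∃ j, N = j + 1 := ⟨N - 1, by omega⟩
  induction k with
  | zero => simp
  | succ k ih =>
    have hj : (j : ℝ) + 1 ≠ 0 := by positivity
    have hk : (k : ℝ) + 1 ≠ 0 := by positivity
    have h1 := succ_mul_multichoose_sub_one_succ (d - k) j
    have h2 := succ_mul_multichoose_succ (d - k) j
    have h3 := succ_mul_multichoose_succ (1 - d) k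
    have h4 := succ_mul_multichoose_sub_one_succ (((j + 1 : ℕ) : ℝ) + d - k) k
    push_cast at *
    rw [show d - ((k : ℝ) + 1) = d - k - 1 by ring,
      show (j : ℝ) + 1 + d - (k + 1) = j + 1 + d - k - 1 by ring]
    have h5 : (j + d - k) * Ring.multichoose (d - k - 1) (j + 1) =
        (d - k - 1) * Ring.multichoose (d - k) (j + 1) := by
      refine mul_left_cancel₀ hj ?_
      linear_combination (j + d - k) * h1 - (d - k - 1) * h2
    refine mul_left_cancel₀ hk ?_
    rw [pow_succ]
    linear_combination (-((-1 : ℝ) ^ k * Ring.multichoose (d - k - 1) (j + 1))) * h4 -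
      (-1 : ℝ) ^ k * Ring.multichoose ((j : ℝ) + 1 + d - k) k * h5 + (k + 1 - d) * ih -
      Ring.multichoose d (j + 1) * h3

/-- Recognizes the binomial quotients of the main term as coefficients of `(y - 1)^k (1 - y)^(-d)`.
The condition `k ≤ N` keeps the denominator positive. -/
theorem mul_choose_div_choose {d : ℝ} (hd : 0 < d) {k N : ℕ} (hN : 1 ≤ N) (hk : k ≤ N) :
    Ring.multichoose d N * (Ring.choose ((k : ℝ) - d) k / Ring.choose ((N : ℝ) + d - 1) k) =
      (-1 : ℝ) ^ k * Ring.multichoose (d - k) N := by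
  have h1 : Ring.choose ((k : ℝ) - d) k = Ring.multichoose (1 - d) k := by
    rw [Ring.multichoose_eq]; congr 1; ring
  have h2 : Ring.choose ((N : ℝ) + d - 1) k = Ring.multichoose ((N : ℝ) + d - k) k := by
    rw [Ring.multichoose_eq]; congr 1; ring
  have hk' : (k : ℝ) ≤ N := by exact_mod_cast hk
  have hpos := multichoose_pos (show 0 < (N : ℝ) + d - k by linarith) k
  rw [h1, h2, ← mul_div_assoc, ← multichoose_sub_mul d k N hN, mul_div_cancel_right₀ _ hpos.ne']

/-- The series of `multichoose d` is `(1 - X)^(-d)`, so each factor `X - 1` lowers the parameter by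
one and flips the sign. -/
theorem mk_multichoose_mul_pow (d : ℝ) (k : ℕ) :
    (PowerSeries.X - 1) ^ k * PowerSeries.mk (Ring.multichoose d) =
      PowerSeries.mk fun j => (-1 : ℝ) ^ k * Ring.multichoose (d - k) j := by
  induction k with
  | zero => simp
  | succ k ih =>
    rw [pow_succ', mul_assoc, ih, sub_mul, one_mul]
    ext j
    rw [map_sub, PowerSeries.coeff_mk, PowerSeries.coeff_mk]
    cases j with
    | zero => simp [pow_succ]
    | succ j =>
      rw [PowerSeries.coeff_succ_X_mul, PowerSeries.coeff_mk, pow_succ]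
      push_cast
      rw [show d - ((k : ℝ) + 1) = d - k - 1 by ring, multichoose_sub_one_succ]
      ring

theorem rpow_ratio_le (p : ℝ) (hp : 0 ≤ p) (j : ℕ) :
    (((j : ℝ) + 2) / (j + 1)) ^ p ≤ Real.exp (p / (j + 1)) := by
  have hj : (0 : ℝ) < j + 1 := by positivity
  have h1 : ((j : ℝ) + 2) / (j + 1) ≤ Real.exp (1 / (j + 1)) := by
    have h2 := Real.add_one_le_exp (1 / ((j : ℝ) + 1))
    have h3 : ((j : ℝ) + 2) / (j + 1) = 1 / ((j : ℝ) + 1) + 1 := by field_simp; ring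
    rw [h3]; exact h2
  calc _ ≤ Real.exp (1 / (j + 1)) ^ p := Real.rpow_le_rpow (by positivity) h1 hp
    _ = _ := by rw [← Real.exp_mul]; congr 1; ring

/-- A bound for the coefficients of `(1 - y) ^ (s - d)`, uniform in `0 < d < 1`. -/
theorem abs_multichoose_mul_rpow_le (s : ℕ) {d : ℝ} (h0 : 0 < d) (h1 : d < 1) (j : ℕ) :
    |Ring.multichoose (d - s) j| * ((j : ℝ) + 1) ^ ((s : ℝ) + 1 - d) ≤
      (((s : ℝ) + 1) * 2 ^ (s + 1)) ^ s := by
  set p : ℝ := (s : ℝ) + 1 - d with hp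
  set B : ℝ := ((s : ℝ) + 1) * 2 ^ (s + 1) with hB
  have hp0 : 0 ≤ p := by
    rw [hp]
    have : (0 : ℝ) ≤ s := by positivity
    linarith
  have hB1 : 1 ≤ B := by
    have h2 : (1 : ℝ) ≤ 2 ^ (s + 1) := one_le_pow₀ one_le_two
    have h3 : (0 : ℝ) ≤ s := by positivity
    rw [hB]; nlinarith
  have hstep : ∀ j : ℕ, |Ring.multichoose (d - s) (j + 1)| * (((j + 1 : ℕ) : ℝ) + 1) ^ p =
      (|Ring.multichoose (d - s) j| * ((j : ℝ) + 1) ^ p) *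
        (|d - s + j| / (j + 1) * (((j : ℝ) + 2) / (j + 1)) ^ p) := fun j => by
    have hj : (0 : ℝ) < j + 1 := by positivity
    have h2 := congrArg abs (succ_mul_multichoose_succ (d - s) j)
    rw [abs_mul, abs_mul, abs_of_pos hj] at h2
    rw [Real.div_rpow (by positivity) hj.le]
    push_cast
    rw [show (j : ℝ) + 1 + 1 = j + 2 by ring]
    have h3 : ((j : ℝ) + 1) ^ p ≠ 0 := (Real.rpow_pos_of_pos hj p).ne'
    field_simp
    linear_combination h2
  -- The weighted coefficient grows by at most a factor `B` in each of the first `s` steps and does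
  -- not grow afterwards.
  have hmin : |Ring.multichoose (d - s) j| * ((j : ℝ) + 1) ^ p ≤ B ^ (min j s) := by
    induction j with
    | zero => simp
    | succ j ih =>
      rw [hstep]
      have hj : (0 : ℝ) < j + 1 := by positivity
      rcases Nat.lt_or_ge j s with hjs | hjs
      · rw [min_eq_left hjs, pow_succ]
        rw [min_eq_left hjs.le] at ih
        have hjs' : (j : ℝ) + 1 ≤ s := by exact_mod_cast hjs
        have hj0 : (0 : ℝ) ≤ j := by positivity
        have h2 : |d - s + j| / (j + 1) ≤ (s : ℝ) + 1 := by
          rw [div_le_iff₀ hj, abs_le]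
          constructor <;> nlinarith
        have h3 : (((j : ℝ) + 2) / (j + 1)) ^ p ≤ 2 ^ (s + 1) := by
          calc (((j : ℝ) + 2) / (j + 1)) ^ p ≤ 2 ^ p := by
                refine Real.rpow_le_rpow (by positivity) ?_ hp0
                rw [div_le_iff₀ hj]; linarith
            _ ≤ 2 ^ ((s + 1 : ℕ) : ℝ) := by
                refine Real.rpow_le_rpow_of_exponent_le one_le_two ?_
                rw [hp]; push_cast; linarith
            _ = 2 ^ (s + 1) := Real.rpow_natCast 2 (s + 1)
        refine mul_le_mul ih ?_ (by positivity) (by positivity)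
        exact mul_le_mul h2 h3 (by positivity) (by positivity)
      · rw [min_eq_right (hjs.trans (Nat.le_succ j))]
        rw [min_eq_right hjs] at ih
        refine (mul_le_of_le_one_right (by positivity) ?_).trans ih
        have hjs' : (s : ℝ) ≤ j := by exact_mod_cast hjs
        rw [abs_of_pos (by linarith)]
        -- The left side is exactly `1 - p / (j + 1)`; the exponential then cancels the one from
        -- `rpow_ratio_le`.
        have h2 : (d - s + j) / (j + 1) ≤ Real.exp (-(p / (j + 1))) := by
          have h3 := Real.add_one_le_exp (-(p / ((j : ℝ) + 1)))
          have h4 : (d - s + j) / (j + 1) = -(p / ((j : ℝ) + 1)) + 1 := by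
            rw [hp]; field_simp; ring
          rw [h4]; exact h3
        calc _ ≤ Real.exp (-(p / (j + 1))) * Real.exp (p / (j + 1)) :=
              mul_le_mul h2 (rpow_ratio_le p hp0 j) (by positivity) (by positivity)
          _ = 1 := by rw [← Real.exp_add, neg_add_cancel, Real.exp_zero]
  exact hmin.trans (pow_le_pow_right₀ hB1 (min_le_right _ _))

/-- Induction on `N`: the ratio `(d + N) / (N + 1)` of consecutive coefficients is at least `(N / (N
+ 1))^(1 - d)` by Bernoulli's inequality with exponent in `[0, 1]`. -/
theorem le_multichoose {d : ℝ} (h0 : 0 < d) (h1 : d < 1) {N : ℕ} (hN : 1 ≤ N) :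
    d * (N : ℝ) ^ (d - 1) ≤ Ring.multichoose d N := by
  induction N, hN using Nat.le_induction with
  | base => simp
  | succ N hN ih =>
    have hN0 : (0 : ℝ) < N := by exact_mod_cast hN
    have hN1 : (0 : ℝ) < (N : ℝ) + 1 := by positivity
    have h2 := succ_mul_multichoose_succ d N
    have h3 := rpow_one_add_le_one_add_mul_self (s := -(1 / ((N : ℝ) + 1)))
      (by rw [neg_le_neg_iff, div_le_one hN1]; linarith) (p := 1 - d) (by linarith) (by linarith)
    have h4 : 1 + -(1 / ((N : ℝ) + 1)) = N / (N + 1) := by field_simp; ring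
    have h5 : 1 + (1 - d) * -(1 / ((N : ℝ) + 1)) = (d + N) / (N + 1) := by field_simp; ring
    rw [h4, h5] at h3
    have h6 : Ring.multichoose d (N + 1) = (d + N) / (N + 1) * Ring.multichoose d N := by
      field_simp
      linear_combination h2
    rw [h6]
    push_cast
    calc d * ((N : ℝ) + 1) ^ (d - 1)
        = ((N : ℝ) / (N + 1)) ^ (1 - d) * (d * (N : ℝ) ^ (d - 1)) := by
          rw [Real.div_rpow hN0.le hN1.le, show d - 1 = -(1 - d) by ring,
            Real.rpow_neg hN1.le, Real.rpow_neg hN0.le]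
          have := (Real.rpow_pos_of_pos hN0 (1 - d)).ne'
          field_simp
      _ ≤ _ := mul_le_mul h3 ih (by positivity) (by positivity)

end Multichoose

/-! ### Taylor expansion of `y^m` at `y = 1` and its effect on coefficients. -/

section TaylorRemainder

theorem sum_choose_succ_mul_pow {R : Type*} [CommRing R] (Y : R) (m n : ℕ) :
    ∑ k ∈ Finset.range (n + 1), ((m + 1).choose k : R) * Y ^ k + (m.choose n : R) * Y ^ (n + 1) =
      (Y + 1) * ∑ k ∈ Finset.range (n + 1), (m.choose k : R) * Y ^ k := by
  induction n with
  | zero => simp; ring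
  | succ n ih =>
    rw [Finset.sum_range_succ, Finset.sum_range_succ (fun k => (m.choose k : R) * Y ^ k),
      mul_add, ← ih, Nat.choose_succ_succ]
    push_cast
    ring

/-- An explicit remainder with nonnegative coefficients in powers of `x`. Because `(x - 1)^(n+1)` is
factored out, it can later be absorbed into `(1 - x)^(-d)`. -/
theorem pow_eq_sum_choose_add {R : Type*} [CommRing R] (x : R) (m n : ℕ) :
    x ^ m = ∑ k ∈ Finset.range (n + 1), (m.choose k : R) * (x - 1) ^ k +
      (x - 1) ^ (n + 1) * ∑ j ∈ Finset.range m, ((m - 1 - j).choose n : R) * x ^ j := by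
  induction m with
  | zero =>
    rw [Finset.sum_range_succ']
    simp
  | succ m ih =>
    rw [Finset.sum_range_succ' _ m, pow_succ', ih, mul_add]
    have h := sum_choose_succ_mul_pow (x - 1) m n
    rw [sub_add_cancel] at h
    rw [← h]
    have h2 : ∑ j ∈ Finset.range m, ((m + 1 - 1 - (j + 1)).choose n : R) * x ^ (j + 1) =
        x * ∑ j ∈ Finset.range m, ((m - 1 - j).choose n : R) * x ^ j := by
      rw [Finset.mul_sum]
      refine Finset.sum_congr rfl fun j _ => ?_
      rw [show m + 1 - 1 - (j + 1) = m - 1 - j by omega, pow_succ']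
      ring
    rw [h2, Nat.add_sub_cancel, Nat.sub_zero, pow_zero, mul_one]
    ring

/-- The `N`-th coefficient of the Taylor remainder of `y ^ m (1 - y) ^ (-d)` at `y = 1`. -/
noncomputable def remainderCoeff (d : ℝ) (n N m : ℕ) : ℝ :=
  (if m ≤ N then Ring.multichoose d (N - m) else 0) -
    ∑ k ∈ Finset.range (n + 1), (m.choose k : ℝ) * ((-1 : ℝ) ^ k * Ring.multichoose (d - k) N)

theorem remainderCoeff_eq_sum (d : ℝ) (n N m : ℕ) :
    remainderCoeff d n N m = ∑ j ∈ Finset.range m, ((m - 1 - j).choose n : ℝ) *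
      (if j ≤ N then (-1 : ℝ) ^ (n + 1) * Ring.multichoose (d - (n + 1 : ℕ)) (N - j) else 0) := by
  have h := congrArg (fun z => PowerSeries.coeff N (z * PowerSeries.mk (Ring.multichoose d)))
    (pow_eq_sum_choose_add (PowerSeries.X : PowerSeries ℝ) m n)
  have hcast : ∀ (c : ℕ) (z : PowerSeries ℝ),
      PowerSeries.coeff N ((c : PowerSeries ℝ) * z) = (c : ℝ) * PowerSeries.coeff N z :=
    fun c z => by rw [← nsmul_eq_mul, map_nsmul, nsmul_eq_mul]
  rw [PowerSeries.coeff_X_pow_mul', PowerSeries.coeff_mk, add_mul, map_add, Finset.sum_mul,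
    map_sum, mul_comm ((PowerSeries.X - 1) ^ (n + 1)), mul_assoc, mk_multichoose_mul_pow,
    Finset.sum_mul, map_sum] at h
  rw [remainderCoeff, h]
  have h1 : ∀ k ∈ Finset.range (n + 1), PowerSeries.coeff N
      ((m.choose k : PowerSeries ℝ) * (PowerSeries.X - 1) ^ k *
        PowerSeries.mk (Ring.multichoose d)) =
      (m.choose k : ℝ) * ((-1 : ℝ) ^ k * Ring.multichoose (d - k) N) := fun k _ => by
    rw [mul_assoc, mk_multichoose_mul_pow, hcast, PowerSeries.coeff_mk]
  rw [Finset.sum_congr rfl h1, add_sub_cancel_left]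
  refine Finset.sum_congr rfl fun j _ => ?_
  rw [mul_assoc, hcast, PowerSeries.coeff_X_pow_mul', PowerSeries.coeff_mk]

theorem remainderCoeff_eq_zero (d : ℝ) {n m : ℕ} (N : ℕ) (hm : m ≤ n) :
    remainderCoeff d n N m = 0 := by
  rw [remainderCoeff_eq_sum]
  refine Finset.sum_eq_zero fun j hj => ?_
  have := Finset.mem_range.mp hj
  rw [Nat.choose_eq_zero_of_lt (by omega), Nat.cast_zero, zero_mul]

/-- The remainder has `m` terms, each with a binomial at most `m^n`. Moving the decay from `N - j`
to `N` costs another `m^(n+2)`, which gives the exponent `2n + 3`. A polynomial loss in `m` is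
affordable against the later geometric weight. -/
theorem abs_remainderCoeff_le (n : ℕ) {d : ℝ} (h0 : 0 < d) (h1 : d < 1) (N m : ℕ) :
    |remainderCoeff d n N m| ≤ ((((n + 1 : ℕ) : ℝ) + 1) * 2 ^ (n + 1 + 1)) ^ (n + 1) *
      (m : ℝ) ^ (2 * n + 3) * ((N : ℝ) + 1) ^ (-((n : ℝ) + 2 - d)) := by
  set B : ℝ := ((((n + 1 : ℕ) : ℝ) + 1) * 2 ^ (n + 1 + 1)) ^ (n + 1) with hB
  set p : ℝ := (n : ℝ) + 2 - d with hp
  have hp0 : 0 ≤ p := by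
    rw [hp]
    have : (0 : ℝ) ≤ n := by positivity
    linarith
  have hN : (0 : ℝ) < (N : ℝ) + 1 := by positivity
  rw [remainderCoeff_eq_sum]
  have hterm : ∀ j ∈ Finset.range m, |((m - 1 - j).choose n : ℝ) *
      (if j ≤ N then (-1 : ℝ) ^ (n + 1) * Ring.multichoose (d - (n + 1 : ℕ)) (N - j) else 0)| ≤
      (m : ℝ) ^ n * (B * ((m : ℝ) ^ (n + 2) * ((N : ℝ) + 1) ^ (-p))) := by
    intro j hj
    have hjm := Finset.mem_range.mp hj
    rw [abs_mul, Nat.abs_cast]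
    have hc : ((m - 1 - j).choose n : ℝ) ≤ (m : ℝ) ^ n := by
      have h2 : (m - 1 - j).choose n ≤ m ^ n :=
        (Nat.choose_le_pow _ _).trans (Nat.pow_le_pow_left (by omega) n)
      exact_mod_cast h2
    refine mul_le_mul hc ?_ (abs_nonneg _) (by positivity)
    split_ifs with hjN
    · rw [abs_mul, abs_pow, abs_neg, abs_one, one_pow, one_mul]
      have hb := abs_multichoose_mul_rpow_le (n + 1) h0 h1 (N - j)
      rw [← hB, show ((n + 1 : ℕ) : ℝ) + 1 - d = p by rw [hp]; push_cast; ring] at hb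
      set c := |Ring.multichoose (d - (n + 1 : ℕ)) (N - j)| with hcdef
      have hM : (0 : ℝ) < ((N - j : ℕ) : ℝ) + 1 := by positivity
      have hMp := Real.rpow_pos_of_pos hM p
      have hNp := Real.rpow_pos_of_pos hN p
      have hle : ((N : ℝ) + 1) ^ p ≤ (m : ℝ) ^ (n + 2) * (((N - j : ℕ) : ℝ) + 1) ^ p := by
        -- Uses `j + 1 ≤ m`.
        have h2 : (N : ℝ) + 1 ≤ m * (((N - j : ℕ) : ℝ) + 1) := by
          have h3 : N + 1 ≤ m * (N - j + 1) := by
            obtain ⟨i, rfl⟩ : ∃ i, N = j + i := ⟨N - j, by omega⟩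
            rw [Nat.add_sub_cancel_left]
            nlinarith [Nat.zero_le i]
          exact_mod_cast h3
        calc ((N : ℝ) + 1) ^ p ≤ (m * (((N - j : ℕ) : ℝ) + 1)) ^ p :=
              Real.rpow_le_rpow hN.le h2 hp0
          _ = (m : ℝ) ^ p * (((N - j : ℕ) : ℝ) + 1) ^ p :=
              Real.mul_rpow (by positivity) hM.le
          _ ≤ _ := by
              refine mul_le_mul_of_nonneg_right ?_ hMp.le
              rw [← Real.rpow_natCast]
              refine Real.rpow_le_rpow_of_exponent_le ?_ ?_
              · exact_mod_cast (by omega : 1 ≤ m)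
              · rw [hp]; push_cast; linarith
      rw [Real.rpow_neg hN.le]
      have hc0 : 0 ≤ c := abs_nonneg _
      rw [← div_eq_mul_inv, ← mul_div_assoc, le_div_iff₀ hNp]
      calc c * ((N : ℝ) + 1) ^ p
          ≤ c * ((m : ℝ) ^ (n + 2) * (((N - j : ℕ) : ℝ) + 1) ^ p) := by gcongr
        _ = (c * (((N - j : ℕ) : ℝ) + 1) ^ p) * (m : ℝ) ^ (n + 2) := by ring
        _ ≤ B * (m : ℝ) ^ (n + 2) := by gcongr
    · rw [abs_zero]; positivity
  refine (Finset.abs_sum_le_sum_abs _ _).trans ((Finset.sum_le_sum hterm).trans_eq ?_)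
  rw [Finset.sum_const, Finset.card_range, nsmul_eq_mul]
  ring

end TaylorRemainder

/-! ### The factorization of the generating series and the error bound. -/

section MeanValue

variable {K : Type u} [Field K] [Fintype K]

theorem isExp_multichoose (d q : ℝ) :
    IsExp (PowerSeries.mk fun j => Ring.multichoose d j * q ^ j)
      (PowerSeries.mk fun m => d * q ^ m / m) := by
  refine isExp_of_coeff_succ (by simp) fun n => ?_
  simp only [PowerSeries.coeff_mk]
  have h1 : ∀ n : ℕ, ∑ p ∈ Finset.HasAntidiagonal.antidiagonal n, d * Ring.multichoose d p.2 =
      ((n : ℝ) + 1) * Ring.multichoose d (n + 1) := fun n => by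
    induction n with
    | zero =>
      rw [Finset.HasAntidiagonal.antidiagonal_zero]
      simp
    | succ n ih =>
      rw [Finset.Nat.sum_antidiagonal_succ, ih]
      have h2 := succ_mul_multichoose_succ d (n + 1)
      rw [h2]
      push_cast
      ring
  rw [← mul_assoc, ← h1, Finset.sum_mul]
  refine Finset.sum_congr rfl fun p hp => ?_
  rw [← Finset.HasAntidiagonal.mem_antidiagonal.mp hp]
  have : (p.1 : ℝ) + 1 ≠ 0 := by positivity
  push_cast
  field_simp
  ring

theorem T_zero {g : K[X] → ℝ} (hg : g 1 = 1) : T g 0 = 1 := by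
  have h : (finite_monicsOfDegree K 0).toFinset = {1} := by
    ext F
    rw [mem_monics, Finset.mem_singleton]
    constructor
    · rintro ⟨h1, h2⟩
      exact h1.natDegree_eq_zero.mp h2
    · rintro rfl
      exact ⟨monic_one, natDegree_one⟩
  rw [T, h, Finset.sum_singleton, hg]

variable {g : K[X] → ℝ} {d : ℕ → ℝ}

/-- Both sides are exponentials of the same series: `k a_k` splits as the excess plus `d₁`, and the
constant part sums to `d₁ q^m` by `primePowerSum_one`. -/
theorem mk_T_eq (hg : IsMultiplicative g) (hd : HasPrimePowerValues g d) :
    PowerSeries.mk (T g) = aSeries K d *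
      PowerSeries.mk fun j => Ring.multichoose (d 1) j * (Fintype.card K : ℝ) ^ j := by
  have h1 : IsExp (PowerSeries.mk (T g))
      (PowerSeries.mk fun m => primePowerSum K (fun k => (k : ℝ) * logCoeff d k) m / m) := by
    refine isExp_of_coeff_succ (by rw [PowerSeries.coeff_mk, T_zero hg.1]) fun n => ?_
    have h := natCast_mul_T hg hd (natCast_mul_fSeries d) (n + 1)
    rw [← sum_antidiagonal_eq_sum_Icc
      (fun m j => primePowerSum K (fun k => (k : ℝ) * logCoeff d k) m * T g j)] at h
    simp only [PowerSeries.coeff_mk]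
    rw [← Nat.cast_succ, h]
    refine Finset.sum_congr rfl fun p _ => ?_
    have : (p.1 : ℝ) + 1 ≠ 0 := by positivity
    push_cast
    field_simp
  have h2 := (isExp_aSeries (K := K) d).mul (isExp_multichoose (d 1) (Fintype.card K : ℝ))
  refine h1.unique ?_
  convert h2 using 1
  ext m
  rw [map_add, logSeries, PowerSeries.coeff_mk, PowerSeries.coeff_mk, PowerSeries.coeff_mk]
  rcases Nat.eq_zero_or_pos m with rfl | hm
  · simp
  · rw [← add_div, ← primePowerSum_one hm, primePowerSum, primePowerSum, primePowerSum,
      Finset.mul_sum, ← Finset.sum_add_distrib]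
    congr 1
    refine Finset.sum_congr rfl fun p _ => ?_
    rw [excess]
    ring

theorem T_eq_sum (hg : IsMultiplicative g) (hd : HasPrimePowerValues g d) (N : ℕ) :
    T g N = (Fintype.card K : ℝ) ^ N * ∑ m ∈ Finset.range (N + 1),
      PowerSeries.coeff m (aSeries K d) * (1 / (Fintype.card K : ℝ)) ^ m *
        (if m ≤ N then Ring.multichoose (d 1) (N - m) else 0) := by
  have hq : (Fintype.card K : ℝ) ≠ 0 := by linarith [two_le_card K]
  have h := congrArg (PowerSeries.coeff N) (mk_T_eq hg hd)
  rw [PowerSeries.coeff_mk, PowerSeries.coeff_mul,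
    Finset.Nat.sum_antidiagonal_eq_sum_range_succ_mk] at h
  rw [h, Finset.mul_sum]
  refine Finset.sum_congr rfl fun m hm => ?_
  have hmN : m ≤ N := Nat.lt_succ_iff.mp (Finset.mem_range.mp hm)
  rw [if_pos hmN, PowerSeries.coeff_mk, one_div, inv_pow]
  have : (Fintype.card K : ℝ) ^ N = (Fintype.card K : ℝ) ^ (N - m) * (Fintype.card K : ℝ) ^ m := by
    rw [← pow_add, Nat.sub_add_cancel hmN]
  rw [this]
  field_simp

theorem norm_one_div_card_lt (K : Type u) [Field K] [Fintype K] :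
    ‖(1 / (Fintype.card K : ℂ))‖ < 1 / Real.sqrt (Fintype.card K) := by
  have hq := two_le_card K
  rw [norm_div, norm_one, Complex.norm_natCast]
  have h0 : 0 < Real.sqrt (Fintype.card K) := Real.sqrt_pos.mpr (by linarith)
  refine one_div_lt_one_div_of_lt h0 ?_
  rw [Real.sqrt_lt' (by linarith)]
  nlinarith

/-- The Taylor coefficients of `a` at `1 / q`, scaled by `q ^ (-k)`. -/
theorem hasSum_iteratedDeriv_a (h0 : 0 < d 1) (h1 : d 1 < 1)
    (ha : ∀ k : ℕ, 1 ≤ k → (k : ℝ) * |logCoeff d k| ≤ 1) (k : ℕ) :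
    HasSum (fun m : ℕ => ((PowerSeries.coeff m (aSeries K d) : ℝ) : ℂ) *
        (1 / (Fintype.card K : ℂ)) ^ m * (m.choose k : ℂ))
      (1 / (Fintype.card K : ℂ) ^ k / (k.factorial : ℂ) *
        iteratedDeriv k (a K d) (1 / (Fintype.card K : ℂ))) := by
  have hq : (Fintype.card K : ℂ) ≠ 0 := by exact_mod_cast Fintype.card_ne_zero
  have hk : (k.factorial : ℂ) ≠ 0 := by exact_mod_cast Nat.factorial_ne_zero k
  have hlt := norm_one_div_card_lt K
  have heq : a K d =ᶠ[nhds (1 / (Fintype.card K : ℂ))]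
      fun x => ∑' m, ((PowerSeries.coeff m (aSeries K d) : ℝ) : ℂ) * x ^ m := by
    filter_upwards [Metric.isOpen_ball.mem_nhds
      (show 1 / (Fintype.card K : ℂ) ∈ Metric.ball 0 (1 / Real.sqrt (Fintype.card K)) from
        mem_ball_zero_iff.mpr hlt)] with x hx
    exact a_eq_tsum h0 h1 ha (mem_ball_zero_iff.mp hx)
  rw [heq.iteratedDeriv_eq k, iteratedDeriv_tsum_mul_pow (summable_aSeries h0 h1 ha) k hlt]
  have hs := ((summable_descFactorial_mul_coeff (summable_aSeries h0 h1 ha) k hlt).hasSum).mul_left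
    (1 / (Fintype.card K : ℂ) ^ k / (k.factorial : ℂ))
  have hsmall : ∑ m ∈ Finset.range k, ((PowerSeries.coeff m (aSeries K d) : ℝ) : ℂ) *
        (1 / (Fintype.card K : ℂ)) ^ m * (m.choose k : ℂ) = 0 :=
    Finset.sum_eq_zero fun m hm => by
      rw [Nat.choose_eq_zero_of_lt (Finset.mem_range.mp hm), Nat.cast_zero, mul_zero]
  rw [← hasSum_nat_add_iff' k, hsmall, sub_zero]
  refine hs.congr_fun fun m => ?_
  rw [Nat.descFactorial_eq_factorial_mul_choose, pow_add, one_div_pow (Fintype.card K : ℂ) k]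
  push_cast
  field_simp

theorem mainTerm_eq (h0 : 0 < d 1) {n N : ℕ} (hN : n + 1 ≤ N) :
    mainTerm K d n N = (Fintype.card K : ℂ) ^ N * ∑ k ∈ Finset.range (n + 1),
      (((-1 : ℝ) ^ k * Ring.multichoose (d 1 - k) N : ℝ) : ℂ) *
        (1 / (Fintype.card K : ℂ) ^ k / (k.factorial : ℂ) *
          iteratedDeriv k (a K d) (1 / (Fintype.card K : ℂ))) := by
  rw [mainTerm, neg_one_pow_mul_choose_neg, Finset.range_eq_Ico,
    Finset.sum_eq_sum_Ico_succ_bot (Nat.succ_pos n), ← Finset.Ico_add_one_right_eq_Icc, mul_add,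
    mul_add, Finset.mul_sum, Finset.mul_sum]
  congr 1
  · simp
    ring
  · refine Finset.sum_congr rfl fun k hk => ?_
    have hk' := Finset.mem_Ico.mp hk
    rw [← mul_choose_div_choose h0 (show 1 ≤ N by omega) (show k ≤ N by omega)]
    push_cast
    ring

/-- `T(N)` and the main term are both linear in the coefficients of `a`, so their difference is one
series whose `m`-th weight is the Taylor remainder of `y^m (1 - y)^(-d₁)`. -/
theorem hasSum_T_sub_mainTerm (hg : IsMultiplicative g) (hd : HasPrimePowerValues g d)
    (h0 : 0 < d 1) (h1 : d 1 < 1)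
    (ha : ∀ k : ℕ, 1 ≤ k → (k : ℝ) * |logCoeff d k| ≤ 1) {n N : ℕ} (hN : n + 1 ≤ N) :
    HasSum (fun m : ℕ => (Fintype.card K : ℂ) ^ N *
        (((PowerSeries.coeff m (aSeries K d) : ℝ) : ℂ) * (1 / (Fintype.card K : ℂ)) ^ m *
          ((remainderCoeff (d 1) n N m : ℝ) : ℂ)))
      (((T g N : ℝ) : ℂ) - mainTerm K d n N) := by
  have hT : HasSum (fun m : ℕ => ((PowerSeries.coeff m (aSeries K d) : ℝ) : ℂ) *
        (1 / (Fintype.card K : ℂ)) ^ m *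
        (((if m ≤ N then Ring.multichoose (d 1) (N - m) else 0 : ℝ)) : ℂ))
      (∑ m ∈ Finset.range (N + 1), ((PowerSeries.coeff m (aSeries K d) : ℝ) : ℂ) *
        (1 / (Fintype.card K : ℂ)) ^ m *
        (((if m ≤ N then Ring.multichoose (d 1) (N - m) else 0 : ℝ)) : ℂ)) := by
    refine hasSum_sum_of_ne_finset_zero fun m hm => ?_
    rw [Finset.mem_range] at hm
    rw [if_neg (by omega), Complex.ofReal_zero, mul_zero]
  have hM := hasSum_sum (s := Finset.range (n + 1)) fun k _ =>
    (hasSum_iteratedDeriv_a (K := K) h0 h1 ha k).mul_left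
      ((((-1 : ℝ) ^ k * Ring.multichoose (d 1 - k) N : ℝ)) : ℂ)
  have h := (hT.sub hM).mul_left ((Fintype.card K : ℂ) ^ N)
  rw [mul_sub, ← mainTerm_eq h0 hN] at h
  have hTe : ((T g N : ℝ) : ℂ) = (Fintype.card K : ℂ) ^ N *
      ∑ m ∈ Finset.range (N + 1), ((PowerSeries.coeff m (aSeries K d) : ℝ) : ℂ) *
        (1 / (Fintype.card K : ℂ)) ^ m *
        (((if m ≤ N then Ring.multichoose (d 1) (N - m) else 0 : ℝ)) : ℂ) := by
    rw [T_eq_sum hg hd N]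
    push_cast
    rfl
  rw [← hTe] at h
  refine h.congr_fun fun m => ?_
  rw [remainderCoeff, Complex.ofReal_sub, Complex.ofReal_sum, mul_sub, Finset.mul_sum]
  congr 2
  refine Finset.sum_congr rfl fun k _ => ?_
  push_cast
  ring

/-- The implied constant in the expansion of `T`. -/
noncomputable def expansionConst (n : ℕ) : ℝ :=
  ((((n + 1 : ℕ) : ℝ) + 1) * 2 ^ (n + 1 + 1)) ^ (n + 1) * 64 * Real.sqrt 2 ^ (n + 1) *
    ∑' m : ℕ, (m : ℝ) ^ (2 * n + 6) * (1 / Real.sqrt 2) ^ m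

theorem one_div_sqrt_two_lt_one : 1 / Real.sqrt 2 < 1 := by
  rw [div_lt_one (by positivity)]
  exact Real.lt_sqrt_of_sq_lt (by norm_num)

theorem summable_expansionConst (n : ℕ) :
    Summable fun m : ℕ => (m : ℝ) ^ (2 * n + 6) * (1 / Real.sqrt 2) ^ m := by
  refine summable_pow_mul_geometric_of_norm_lt_one (2 * n + 6) ?_
  rw [Real.norm_of_nonneg (by positivity)]
  exact one_div_sqrt_two_lt_one

theorem expansionConst_pos (n : ℕ) : 0 < expansionConst n := by
  have h := (summable_expansionConst n).tsum_pos (fun m => by positivity) 1 (by positivity)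
  rw [expansionConst]
  positivity

/-- The left side is `q^(-m/2)`: `n + 1` factors are kept as the saving in `q`, and the others are
bounded through `q ≥ 2`, which leaves a convergent weight independent of `q`. -/
theorem sqrt_inv_pow_le {q : ℝ} (hq : 2 ≤ q) {n m : ℕ} (hm : n + 1 ≤ m) :
    Real.sqrt q ^ m * (1 / q) ^ m ≤
      (1 / Real.sqrt q) ^ (n + 1) * (Real.sqrt 2 ^ (n + 1) * (1 / Real.sqrt 2) ^ m) := by
  have hs : 0 < Real.sqrt q := Real.sqrt_pos.mpr (by linarith)
  have h2 : 0 < Real.sqrt 2 := by positivity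
  have h1 : Real.sqrt q * (1 / q) = 1 / Real.sqrt q := by
    have := Real.mul_self_sqrt (show 0 ≤ q by linarith)
    have hq0 : q ≠ 0 := by linarith
    field_simp
    nlinarith
  obtain ⟨i, rfl⟩ : ∃ i, m = n + 1 + i := ⟨m - (n + 1), by omega⟩
  rw [← mul_pow, h1, pow_add, pow_add (1 / Real.sqrt 2), ← mul_assoc (Real.sqrt 2 ^ (n + 1)),
    ← mul_pow, mul_one_div_cancel h2.ne', one_pow, one_mul]
  gcongr

theorem norm_T_sub_mainTerm_le (hg : IsMultiplicative g) (hd : HasPrimePowerValues g d)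
    (h0 : 0 < d 1) (h1 : d 1 < 1)
    (ha : ∀ k : ℕ, 1 ≤ k → (k : ℝ) * |logCoeff d k| ≤ 1) {n N : ℕ} (hN : n + 1 ≤ N) :
    ‖((T g N : ℝ) : ℂ) - mainTerm K d n N‖ ≤
      expansionConst n * ((Fintype.card K : ℝ) ^ N * (N : ℝ) ^ (d 1 - 1) *
        (1 / (Real.sqrt (Fintype.card K) * N)) ^ (n + 1)) := by
  have hsum := hasSum_T_sub_mainTerm hg hd h0 h1 ha hN
  have hq := two_le_card K
  have hq1 : ‖(Fintype.card K : ℂ)‖ = (Fintype.card K : ℝ) := Complex.norm_natCast _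
  set q : ℝ := (Fintype.card K : ℝ) with hqdef
  set B : ℝ := ((((n + 1 : ℕ) : ℝ) + 1) * 2 ^ (n + 1 + 1)) ^ (n + 1) with hB
  set s : ℝ := (1 / Real.sqrt q) ^ (n + 1) with hs
  set P : ℝ := ((N : ℝ) + 1) ^ (-((n : ℝ) + 2 - d 1)) with hP
  have hP0 : 0 ≤ P := by positivity
  have hN0 : (0 : ℝ) < N := by exact_mod_cast (by omega : 0 < N)
  have hbound := (summable_expansionConst n).hasSum.mul_left
    (q ^ N * P * s * (B * 64 * Real.sqrt 2 ^ (n + 1)))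
  have hle := hsum.norm_le_of_bounded hbound fun m => ?_
  · refine hle.trans ?_
    have hPle : P ≤ (N : ℝ) ^ (d 1 - 1) * (1 / (N : ℝ)) ^ (n + 1) := by
      have h2 : (N : ℝ) ^ (d 1 - 1) * (1 / (N : ℝ)) ^ (n + 1) =
          (N : ℝ) ^ (-((n : ℝ) + 2 - d 1)) := by
        rw [one_div, inv_pow, ← Real.rpow_natCast, ← Real.rpow_neg hN0.le, ← Real.rpow_add hN0]
        congr 1
        push_cast
        ring
      rw [h2, hP]
      refine Real.rpow_le_rpow_of_nonpos hN0 (by linarith) ?_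
      have : (0 : ℝ) ≤ n := by positivity
      linarith
    have hC := (expansionConst_pos n).le
    calc _ = expansionConst n * (q ^ N * s * P) := by rw [expansionConst, ← hB]; ring
      _ ≤ expansionConst n * (q ^ N * s * ((N : ℝ) ^ (d 1 - 1) * (1 / (N : ℝ)) ^ (n + 1))) := by
          gcongr
      _ = _ := by
          rw [hs, ← one_div_mul_one_div, mul_pow]
          ring
  · rw [norm_mul, norm_mul, norm_mul, norm_pow, norm_pow, norm_div, norm_one, hq1,
      Complex.norm_real, Complex.norm_real, Real.norm_eq_abs, Real.norm_eq_abs]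
    rcases Nat.lt_or_ge n m with hm | hm
    · have hα := abs_coeff_aSeries_le (K := K) h0 h1 ha m
      have hD := abs_remainderCoeff_le n h0 h1 N m
      rw [← hqdef] at hα
      rw [← hB, ← hP] at hD
      -- Here `m ≥ 1`, so `m + 3 ≤ 4 m`; this is the `64` in `expansionConst`.
      have hc : ((m + 3).choose 3 : ℝ) ≤ 64 * (m : ℝ) ^ 3 := by
        have h2 : (m + 3).choose 3 ≤ (4 * m) ^ 3 :=
          (Nat.choose_le_pow _ _).trans (Nat.pow_le_pow_left (by omega) 3)
        have h3 : ((m + 3).choose 3 : ℝ) ≤ (4 * m) ^ 3 := by exact_mod_cast h2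
        linarith [mul_pow (4 : ℝ) m 3]
      have hsq := sqrt_inv_pow_le hq (Nat.succ_le_of_lt hm)
      rw [← hs] at hsq
      calc q ^ N * (|PowerSeries.coeff m (aSeries K d)| * (1 / q) ^ m *
            |remainderCoeff (d 1) n N m|)
          ≤ q ^ N * ((Real.sqrt q ^ m * (64 * (m : ℝ) ^ 3)) * (1 / q) ^ m *
            (B * (m : ℝ) ^ (2 * n + 3) * P)) := by
            gcongr
            exact hα.trans (by gcongr)
        _ = q ^ N * P * B * 64 * (m : ℝ) ^ (2 * n + 6) * (Real.sqrt q ^ m * (1 / q) ^ m) := by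
            ring
        _ ≤ q ^ N * P * B * 64 * (m : ℝ) ^ (2 * n + 6) *
            (s * (Real.sqrt 2 ^ (n + 1) * (1 / Real.sqrt 2) ^ m)) := by
            gcongr
        _ = _ := by ring
    · rw [remainderCoeff_eq_zero _ _ hm, abs_zero, mul_zero, mul_zero]
      positivity

end MeanValue

/-! ### Lower bounds for the main term and the limit `q^N → ∞`. -/

section Asymptotics

variable {d : ℕ → ℝ}

/-- A lower bound for `|a(1/q)|` uniform in `q`. -/
theorem exp_neg_le_norm_a (K : Type u) [Field K] [Fintype K] (h0 : 0 < d 1) (h1 : d 1 < 1)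
    (ha : ∀ k : ℕ, 1 ≤ k → (k : ℝ) * |logCoeff d k| ≤ 1) :
    Real.exp (-∑' m : ℕ, 4 * (1 / Real.sqrt 2) ^ m) ≤ ‖a K d (1 / (Fintype.card K : ℂ))‖ := by
  have hq := two_le_card K
  have hs := (summable_geometric_of_lt_one (by positivity) one_div_sqrt_two_lt_one).mul_left 4
  rw [a_eq_exp h0 h1 ha (norm_one_div_card_lt K), Complex.norm_exp, Real.exp_le_exp]
  have hb := hs.hasSum
  have hle := tsum_of_norm_bounded hb fun m =>
    (norm_logSeries_term_le (K := K) h0 h1 ha (1 / (Fintype.card K : ℂ)) m).trans ?_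
  · exact neg_le_of_abs_le ((Complex.abs_re_le_norm _).trans hle)
  · rw [norm_div, norm_one, Complex.norm_natCast]
    have h2 : Real.sqrt (Fintype.card K) * (1 / (Fintype.card K : ℝ)) ≤ 1 / Real.sqrt 2 := by
      have h3 := sqrt_inv_pow_le hq (n := 0) (m := 1) le_rfl
      have h4 : Real.sqrt 2 * (1 / Real.sqrt 2) = 1 := mul_one_div_cancel (by positivity)
      simp only [zero_add, pow_one, h4, mul_one] at h3
      refine h3.trans ?_
      gcongr
    gcongr

theorem le_norm_mainTerm_zero (K : Type u) [Field K] [Fintype K] (h0 : 0 < d 1) (h1 : d 1 < 1)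
    (ha : ∀ k : ℕ, 1 ≤ k → (k : ℝ) * |logCoeff d k| ≤ 1) {N : ℕ} (hN : 1 ≤ N) :
    d 1 * Real.exp (-∑' m : ℕ, 4 * (1 / Real.sqrt 2) ^ m) *
      ((Fintype.card K : ℝ) ^ N * (N : ℝ) ^ (d 1 - 1)) ≤ ‖mainTerm K d 0 N‖ := by
  have hpos := multichoose_pos h0 N
  have h2 := le_multichoose h0 h1 hN
  have h3 := exp_neg_le_norm_a K h0 h1 ha
  rw [mainTerm, Finset.Icc_eq_empty (by norm_num), Finset.sum_empty, add_zero,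
    neg_one_pow_mul_choose_neg, norm_mul, Complex.norm_real, Real.norm_of_nonneg (by positivity)]
  calc _ = (d 1 * (N : ℝ) ^ (d 1 - 1)) * (Fintype.card K : ℝ) ^ N *
        Real.exp (-∑' m : ℕ, 4 * (1 / Real.sqrt 2) ^ m) := by ring
    _ ≤ _ := by gcongr

/-- If `√q N < b` with `q, N ≥ 1`, then `q ≤ b²` and `N ≤ b`, so `q^N` is bounded. -/
theorem exists_forall_sqrt_mul_gt (B : ℝ) :
    ∃ M : ℝ, ∀ q N : ℕ, 1 ≤ q → 1 ≤ N → M ≤ (q : ℝ) ^ N → B < Real.sqrt q * N := by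
  obtain ⟨b, hb⟩ := exists_nat_gt (max B 1)
  have hb1 : 1 < b := by exact_mod_cast (le_max_right B 1).trans_lt hb
  refine ⟨((b : ℝ) ^ 2) ^ b + 1, fun q N hq hN hM => ?_⟩
  refine (le_max_left B 1).trans_lt (hb.trans_le ?_)
  by_contra! hlt
  have hq1 : (1 : ℝ) ≤ q := by exact_mod_cast hq
  have hN1 : (1 : ℝ) ≤ N := by exact_mod_cast hN
  have hs1 : 1 ≤ Real.sqrt q := Real.one_le_sqrt.mpr hq1
  have hqb : (q : ℝ) ≤ (b : ℝ) ^ 2 := by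
    rw [← Real.sqrt_le_left (by positivity)]
    nlinarith
  have hNb : N ≤ b := by
    have : (N : ℝ) ≤ b := by nlinarith
    exact_mod_cast this
  have : (q : ℝ) ^ N ≤ ((b : ℝ) ^ 2) ^ b := by
    calc (q : ℝ) ^ N ≤ (q : ℝ) ^ b := pow_le_pow_right₀ hq1 hNb
      _ ≤ _ := by gcongr
  linarith

theorem exists_forall_norm_T_sub_mainTerm_le (n : ℕ) (h0 : 0 < d 1) (h1 : d 1 < 1)
    (ha : ∀ k : ℕ, 1 ≤ k → (k : ℝ) * |logCoeff d k| ≤ 1) {ε : ℝ} (hε : 0 < ε) :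
    ∃ M : ℝ, ∀ (K : Type u) [Field K] [Fintype K] (g : K[X] → ℝ),
      IsMultiplicative g → HasPrimePowerValues g d →
      ∀ N : ℕ, n + 1 ≤ N → M ≤ (Fintype.card K : ℝ) ^ N →
        mainTerm K d n N ≠ 0 ∧
        ‖((T g N : ℝ) : ℂ) - mainTerm K d n N‖ ≤ ε * ‖mainTerm K d n N‖ := by
  set c : ℝ := d 1 * Real.exp (-∑' m : ℕ, 4 * (1 / Real.sqrt 2) ^ m) with hc
  have hc0 : 0 < c := by positivity
  have hCn := expansionConst_pos n
  have hC0 := expansionConst_pos 0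
  set A : ℝ := expansionConst n + expansionConst 0 with hA
  -- The `1` makes `δ ≤ 1`. The other entry gives `c > (A + A / ε) δ`: the part `A δ` pays for
  -- passing from order `0` to order `n`, and the part `(A / ε) δ` remains as a lower bound.
  obtain ⟨M, hM⟩ := exists_forall_sqrt_mul_gt (max 1 ((A + A / ε) / c))
  refine ⟨M, fun K _ _ g hg hd N hN hMN => ?_⟩
  have hN1 : 1 ≤ N := by omega
  have hB := hM (Fintype.card K) N Fintype.card_pos hN1 hMN
  have hB1 := (le_max_left _ _).trans_lt hB
  have hB2 := (le_max_right _ _).trans_lt hB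
  have hR := norm_T_sub_mainTerm_le hg hd h0 h1 ha hN
  have hR0 := norm_T_sub_mainTerm_le (n := 0) hg hd h0 h1 ha hN1
  have hL := le_norm_mainTerm_zero K h0 h1 ha hN1
  have hq := two_le_card K
  have hN0 : (0 : ℝ) < N := by exact_mod_cast hN1
  rw [← hc] at hL
  set W : ℝ := (Fintype.card K : ℝ) ^ N * (N : ℝ) ^ (d 1 - 1) with hW
  have hW0 : 0 < W := by positivity
  set δ : ℝ := 1 / (Real.sqrt (Fintype.card K) * N) with hδ
  have hδ0 : 0 < δ := one_div_pos.mpr (one_pos.trans hB1)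
  have hδ1 : δ ≤ 1 := by rw [hδ, div_le_one (one_pos.trans hB1)]; exact hB1.le
  have hδn : δ ^ (n + 1) ≤ δ := pow_le_of_le_one hδ0.le hδ1 (Nat.succ_ne_zero n)
  rw [zero_add, pow_one] at hR0
  have hRn : ‖((T g N : ℝ) : ℂ) - mainTerm K d n N‖ ≤ expansionConst n * (W * δ) :=
    hR.trans (by gcongr)
  -- The two main terms are compared through `T(N)`, so no bound on the derivatives of `a` is
  -- needed.
  have htri : ‖mainTerm K d 0 N‖ ≤ ‖mainTerm K d n N‖ +
      ‖((T g N : ℝ) : ℂ) - mainTerm K d n N‖ + ‖((T g N : ℝ) : ℂ) - mainTerm K d 0 N‖ := by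
    have h2 : mainTerm K d 0 N = mainTerm K d n N + (((T g N : ℝ) : ℂ) - mainTerm K d n N) -
        (((T g N : ℝ) : ℂ) - mainTerm K d 0 N) := by ring
    conv_lhs => rw [h2]
    exact (norm_sub_le _ _).trans (by gcongr; exact norm_add_le _ _)
  have hkey : (A + A / ε) * δ < c := by
    rw [hδ, mul_one_div, div_lt_iff₀ (one_pos.trans hB1)]
    rw [div_lt_iff₀ hc0] at hB2
    linarith
  have hlow : A / ε * (W * δ) < ‖mainTerm K d n N‖ := by
    have h3 : (A + A / ε) * δ * W < c * W := mul_lt_mul_of_pos_right hkey hW0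
    rw [hA] at h3 ⊢
    nlinarith
  have hA0 : 0 < A := by positivity
  refine ⟨fun h => ?_, ?_⟩
  · rw [h, norm_zero] at hlow
    have : 0 < A / ε * (W * δ) := by positivity
    linarith
  · have h4 : A * (W * δ) ≤ ε * ‖mainTerm K d n N‖ := by
      calc A * (W * δ) = ε * (A / ε * (W * δ)) := by field_simp
        _ ≤ _ := by gcongr
    have h5 : expansionConst n * (W * δ) ≤ A * (W * δ) := by
      gcongr
      rw [hA]; linarith
    linarith

end Asymptotics

end FqMean

theorem mainTheorem3 :
    -- convergence of `f` and of the infinite product `a`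
    (∀ (K : Type u) [Field K] [Fintype K] (d : ℕ → ℝ),
      0 < d 1 → d 1 < 1 → (∀ k : ℕ, 1 ≤ k → (k : ℝ) * |FqMean.logCoeff d k| ≤ 1) →
      (∀ t : ℂ, ‖t‖ < 1 →
        Summable fun k : ℕ => ((PowerSeries.coeff k (FqMean.fSeries d) : ℝ) : ℂ) * t ^ k) ∧
      (∀ x : ℂ, ‖x‖ < 1 / Real.sqrt (Fintype.card K) →
        (Multipliable fun l : ℕ => FqMean.factor K d (l + 1) x) ∧ FqMean.a K d x ≠ 0) ∧
      DifferentiableOn ℂ (FqMean.a K d)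
        (Metric.ball (0 : ℂ) (1 / Real.sqrt (Fintype.card K)))) ∧
    -- the expansion of `T(N)`, with an implied constant depending only on `n`
    (∀ n : ℕ, ∃ C : ℝ, 0 < C ∧
      ∀ (K : Type u) [Field K] [Fintype K] (d : ℕ → ℝ) (g : Polynomial K → ℝ),
        0 < d 1 → d 1 < 1 → (∀ k : ℕ, 1 ≤ k → (k : ℝ) * |FqMean.logCoeff d k| ≤ 1) →
        FqMean.IsMultiplicative g → FqMean.HasPrimePowerValues g d →
        ∀ N : ℕ, n + 1 ≤ N →
          ‖((FqMean.T g N : ℝ) : ℂ) - FqMean.mainTerm K d n N‖ ≤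
            C * ((Fintype.card K : ℝ) ^ N * (N : ℝ) ^ (d 1 - 1) *
              (1 / (Real.sqrt (Fintype.card K) * N)) ^ (n + 1))) ∧
    -- for fixed `(d_k)` and `n`, the main term is asymptotic to `T(N)` as `q ^ N → ∞`
    (∀ (n : ℕ) (d : ℕ → ℝ),
      0 < d 1 → d 1 < 1 → (∀ k : ℕ, 1 ≤ k → (k : ℝ) * |FqMean.logCoeff d k| ≤ 1) →
      ∀ ε : ℝ, 0 < ε → ∃ M : ℝ,
        ∀ (K : Type u) [Field K] [Fintype K] (g : Polynomial K → ℝ),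
          FqMean.IsMultiplicative g → FqMean.HasPrimePowerValues g d →
          ∀ N : ℕ, n + 1 ≤ N → M ≤ (Fintype.card K : ℝ) ^ N →
            FqMean.mainTerm K d n N ≠ 0 ∧
            ‖((FqMean.T g N : ℝ) : ℂ) - FqMean.mainTerm K d n N‖ ≤
              ε * ‖FqMean.mainTerm K d n N‖) := by
  refine ⟨?_, ?_, ?_⟩
  · intro K _ _ d h0 h1 ha
    refine ⟨fun t ht => FqMean.summable_fSeries ha ht, fun x hx => ⟨?_, ?_⟩,
      FqMean.differentiableOn_a h0 h1 ha⟩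
    · exact (FqMean.hasProd_factor h0 h1 ha hx).multipliable
    · rw [FqMean.a_eq_exp h0 h1 ha hx]
      exact Complex.exp_ne_zero _
  · intro n
    exact ⟨FqMean.expansionConst n, FqMean.expansionConst_pos n,
      fun K _ _ d g h0 h1 ha hg hd N hN => FqMean.norm_T_sub_mainTerm_le hg hd h0 h1 ha hN⟩
  · intro n d h0 h1 ha ε hε
    exact FqMean.exists_forall_norm_T_sub_mainTerm_le n h0 h1 ha hε
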